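/- Let $(M,g)$ be a smooth, finite-dimensional, complete Riemannian manifold without boundary, and let $D\subseteq TM$ be a smooth subbundle that is bracket-generating: at every point $p\in M$ the iterated Lie brackets of smooth sections of $D$ span $T_pM$. Let $P$ and $P^\perp$ denote the $g$-orthogonal projections of $TM$ onto $D$ and $D^\perp$, and for each integer $q\ge 1$ put $$g_q(v,w)=g(Pv,Pw)+q\,g(P^\perp v,P^\perp w).$$ Let $x,y\in M$, and for every $q\ge 1$ let $\gamma_q:[0,1]\to M$ be a length-minimising, constant-speed geodesic of $g_q$ with $\gamma_q(0)=x$ and $\gamma_q(1)=y$. Here length-minimising means that the $g_q$-length of $\gamma_q$ equals the $g_q$-distance $d_q(x,y)$, the infimum of the $g_q$-lengths of $C^1$ curves from $x$ to $y$. Then there are a subsequence $(\gamma_{q_j})_j$, with $q_1<q_2<\cdots$, and a continuous path $\gamma:[0,1]\to M$ from $x$ to $y$ such that $\gamma_{q_j}\to\gamma$ uniformly on $[0,1]$ with respect to the Riemannian distance of $g$, that is, in $C^0([0,1],M)$. -/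

import Mathlib

open Set Filter Topology MeasureTheory Bundle Manifold
open scoped ENNReal ContDiff

noncomputable section SubRiemannian

variable {E : Type*} [NormedAddCommGroup E] [NormedSpace ℝ E]
  {M : Type*} [TopologicalSpace M] [ChartedSpace E M] [IsManifold 𝓘(ℝ, E) ∞ M]

/-- A family of subspaces `D x ⊆ T_x M` is a smooth subbundle of `TM` if, near every point, it
admits a smooth local frame (its rank is then locally constant). -/
def IsSmoothSubbundle (D : ∀ x : M, Submodule ℝ (TangentSpace 𝓘(ℝ, E) x)) : Prop :=
  ∀ x₀ : M, ∃ U : Set M, IsOpen U ∧ x₀ ∈ U ∧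
    ∃ (k : ℕ) (X : Fin k → ∀ x : M, TangentSpace 𝓘(ℝ, E) x),
      (∀ i, ContMDiffOn 𝓘(ℝ, E) 𝓘(ℝ, E).tangent ∞
        (fun x ↦ (⟨x, X i x⟩ : TangentBundle 𝓘(ℝ, E) M)) U) ∧
      ∀ x ∈ U, LinearIndependent ℝ (fun i ↦ X i x) ∧
        Submodule.span ℝ (range fun i ↦ X i x) = D x

/-- The iterated Lie brackets of smooth sections of `D`. -/
inductive IsIteratedBracket (D : ∀ x : M, Submodule ℝ (TangentSpace 𝓘(ℝ, E) x)) :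
    (∀ x : M, TangentSpace 𝓘(ℝ, E) x) → Prop
  | of_section (X : ∀ x : M, TangentSpace 𝓘(ℝ, E) x)
      (smooth : ContMDiff 𝓘(ℝ, E) 𝓘(ℝ, E).tangent ∞
        (fun x ↦ (⟨x, X x⟩ : TangentBundle 𝓘(ℝ, E) M)))
      (mem : ∀ x, X x ∈ D x) : IsIteratedBracket D X
  | bracket (X Y : ∀ x : M, TangentSpace 𝓘(ℝ, E) x)
      (hX : IsIteratedBracket D X) (hY : IsIteratedBracket D Y) :
      IsIteratedBracket D (VectorField.mlieBracket 𝓘(ℝ, E) X Y)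

/-- `D` is bracket-generating: at every point, the iterated Lie brackets of smooth sections of `D`
span the whole tangent space. -/
def IsBracketGenerating (D : ∀ x : M, Submodule ℝ (TangentSpace 𝓘(ℝ, E) x)) : Prop :=
  ∀ x : M, Submodule.span ℝ {v | ∃ X, IsIteratedBracket D X ∧ X x = v} = ⊤

variable [FiniteDimensional ℝ E] [RiemannianBundle (fun x : M ↦ TangentSpace 𝓘(ℝ, E) x)]

/-- Subspaces of a tangent space admit orthogonal projections, by finite-dimensionality. -/
instance tangentSubspaceHasOrthogonalProjection (x : M)
    (K : Submodule ℝ (TangentSpace 𝓘(ℝ, E) x)) : K.HasOrthogonalProjection := by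
  have : FiniteDimensional ℝ (TangentSpace 𝓘(ℝ, E) x) := inferInstanceAs (FiniteDimensional ℝ E)
  infer_instance

/-- The penalised metric `g_q(v, w) = g(P v, P w) + q g(P^⊥ v, P^⊥ w)`, where `g` is the Riemannian
metric of `M`, and `P`, `P^⊥` are the `g`-orthogonal projections onto `D` and `D^⊥`. -/
def penalisedMetric (D : ∀ x : M, Submodule ℝ (TangentSpace 𝓘(ℝ, E) x)) (q : ℕ+) (x : M)
    (v w : TangentSpace 𝓘(ℝ, E) x) : ℝ :=
  inner ℝ ((D x).starProjection v) ((D x).starProjection w) +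
    (q : ℝ) * inner ℝ ((D x)ᗮ.starProjection v) ((D x)ᗮ.starProjection w)

/-- The squared `g_q`-speed `g_q(γ'(t), γ'(t))` of a curve `γ : [0,1] → M`. -/
def penalisedSpeedSq (D : ∀ x : M, Submodule ℝ (TangentSpace 𝓘(ℝ, E) x)) (q : ℕ+)
    (γ : unitInterval → M) (t : unitInterval) : ℝ :=
  penalisedMetric D q (γ t) (mfderiv (𝓡∂ 1) 𝓘(ℝ, E) γ t 1) (mfderiv (𝓡∂ 1) 𝓘(ℝ, E) γ t 1)

/-- The length `l_q(γ) = ∫₀¹ √(g_q(γ'(t), γ'(t))) dt`. -/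
def penalisedLength (D : ∀ x : M, Submodule ℝ (TangentSpace 𝓘(ℝ, E) x)) (q : ℕ+)
    (γ : unitInterval → M) : ℝ≥0∞ :=
  ∫⁻ t, ENNReal.ofReal (√(penalisedSpeedSq D q γ t))

/-- The distance `d_q` induced by `g_q`: the infimum of the `g_q`-lengths of `C^1` curves. -/
def penalisedEDist (D : ∀ x : M, Submodule ℝ (TangentSpace 𝓘(ℝ, E) x)) (q : ℕ+)
    (x y : M) : ℝ≥0∞ :=
  ⨅ (γ : Path x y) (_ : ContMDiff (𝓡∂ 1) 𝓘(ℝ, E) 1 γ), penalisedLength D q γ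

/-- `γ` is a length-minimising, constant-speed geodesic of `g_q` from `x` to `y`. (A `C^1` curve
with constant `g_q`-speed whose length is the `g_q`-distance of its endpoints automatically solves
the geodesic equation of `g_q`, and conversely minimising geodesics have these properties.) -/
structure IsMinimisingGeodesic (D : ∀ x : M, Submodule ℝ (TangentSpace 𝓘(ℝ, E) x)) (q : ℕ+)
    {x y : M} (γ : Path x y) : Prop where
  contMDiff : ContMDiff (𝓡∂ 1) 𝓘(ℝ, E) 1 γ
  constant_speed : ∃ c : ℝ, ∀ t, penalisedSpeedSq D q γ t = c
  length_eq : penalisedLength D q γ = penalisedEDist D q x y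

end SubRiemannian

/-!
The whole proof is a bound on the distances `d_q(x, y)` that is uniform in `q`. A minimising
geodesic of `g_q` has constant `g_q`-speed `d_q(x, y)`, and `g ≤ g_q`, so under such a bound the
geodesics are equi-Lipschitz for `g`; in a complete, locally compact space equi-Lipschitz paths with
a common starting point are pointwise relatively compact (`totallyBounded_range_of_lipschitzWith`),
and Arzelà–Ascoli gives the subsequence (`exists_subseq_of_horizontalEDist_ne_top`).

The bound is a weak form of the Chow–Rashevskii theorem. Set `horizontalEDist = sup_q d_q`, an
extended pseudodistance. Since the penalty does not see vectors of `D`, a horizontal curve bounds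
it by its `g`-length. It is enough to show that each point has a neighbourhood at finite
`horizontalEDist`: the points at finite `horizontalEDist` from `x` then form a clopen set, which
contains `y` because some path joins `x` to `y` (`IsBracketGenerating.horizontalEDist_ne_top`).

Locally, in a chart, sections of `D` are cut off and their flows are expanded by Taylor's formula:
`f ∘ Φ_t = ∑ tʲ Vʲ f / j!`, the formal exponential of `V` in the ring of power series over the
endomorphisms of the smooth maps (`hasExpansion_flow`). Compositions of motions multiply expansions
(`HasExpansion.comp`), and the group commutator of `1 + u Xᵏ + ⋯` and `1 + w Xˡ + ⋯` is
`1 + (u w - w u) Xᵏ⁺ˡ + ⋯`. So every iterated bracket `V`, of some length `k`, is followed up to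
`o(tᵏ)` by a concatenation of horizontal curves of length `O(t)` (`IsRealized.commutator`). If the
brackets span the tangent space, every small displacement `a` is therefore attained up to `o(a)` at
a cost `O(|a|^α)` (`IsBracketGenerating.isAttainable_id`). Repeating with the remaining displacement
as the new target converges to any nearby point at finite total cost
(`IsAttainable.exists_seq_tendsto`). The target is reached only in the limit, but this is enough:
each single `d_q` is continuous, so bounds on `horizontalEDist` pass to limits
(`horizontalEDist_le_of_tendsto`). No openness of an endpoint map and no differentiability of the
motions in their starting point is needed.
-/

noncomputable section

/-! ### Penalised distances and their supremum -/

section PenalisedDistance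

variable {E : Type*} [NormedAddCommGroup E] [NormedSpace ℝ E] [FiniteDimensional ℝ E]
  {M : Type*} [TopologicalSpace M] [ChartedSpace E M]
  [RiemannianBundle (fun x : M ↦ TangentSpace 𝓘(ℝ, E) x)]
  (D : ∀ x : M, Submodule ℝ (TangentSpace 𝓘(ℝ, E) x))

theorem penalisedMetric_self (q : ℕ+) (x : M) (v : TangentSpace 𝓘(ℝ, E) x) :
    penalisedMetric D q x v v =
      ‖(D x).starProjection v‖ ^ 2 + q * ‖(D x)ᗮ.starProjection v‖ ^ 2 := by
  simp only [penalisedMetric, real_inner_self_eq_norm_sq]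

theorem norm_sq_le_penalisedMetric (q : ℕ+) (x : M) (v : TangentSpace 𝓘(ℝ, E) x) :
    ‖v‖ ^ 2 ≤ penalisedMetric D q x v v := by
  rw [penalisedMetric_self, (D x).norm_sq_eq_add_norm_sq_starProjection v]
  have : (1 : ℝ) ≤ q := by exact_mod_cast one_le
  nlinarith [sq_nonneg ‖(D x)ᗮ.starProjection v‖]

theorem penalisedMetric_le (q : ℕ+) (x : M) (v : TangentSpace 𝓘(ℝ, E) x) :
    penalisedMetric D q x v v ≤ q * ‖v‖ ^ 2 := by
  rw [penalisedMetric_self, (D x).norm_sq_eq_add_norm_sq_starProjection v]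
  have : (1 : ℝ) ≤ q := by exact_mod_cast one_le
  nlinarith [sq_nonneg ‖(D x).starProjection v‖]

theorem penalisedMetric_of_mem (q : ℕ+) (x : M) {v : TangentSpace 𝓘(ℝ, E) x} (hv : v ∈ D x) :
    penalisedMetric D q x v v = ‖v‖ ^ 2 := by
  rw [penalisedMetric_self, Submodule.starProjection_eq_self_iff.2 hv,
    Submodule.starProjection_apply_eq_zero_iff _ |>.2 (by
      simpa using (Submodule.le_orthogonal_orthogonal _) hv)]
  simp

/-- The norm of the penalised metric `g_q`, as an extended norm on the tangent spaces. -/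
@[reducible] def penalisedENorm (q : ℕ+) (x : M) : ENorm (TangentSpace 𝓘(ℝ, E) x) :=
  ⟨fun v ↦ ENNReal.ofReal √(penalisedMetric D q x v v)⟩

theorem penalisedENorm_smulClass (q : ℕ+) (x : M) :
    @ENormSMulClass ℝ (TangentSpace 𝓘(ℝ, E) x) _ (penalisedENorm D q x) _ := by
  let := penalisedENorm D q x
  refine ⟨fun r v ↦ ?_⟩
  change ENNReal.ofReal _ = ‖r‖ₑ * ENNReal.ofReal _
  have : penalisedMetric D q x (r • v) (r • v) = |r| ^ 2 * penalisedMetric D q x v v := by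
    simp only [penalisedMetric, map_smul, inner_smul_left, inner_smul_right, sq_abs]
    simp; ring
  rw [this, Real.sqrt_mul (by positivity), Real.sqrt_sq (abs_nonneg r),
    ENNReal.ofReal_mul (abs_nonneg r), Real.enorm_eq_ofReal_abs]

/-- The distance `d_q` is the Finsler distance of the extended norm attached to `g_q`. -/
theorem penalisedEDist_eq_riemannianEDist (q : ℕ+) (x y : M) :
    penalisedEDist D q x y =
      @riemannianEDist E _ _ E _ 𝓘(ℝ, E) M _ _ (penalisedENorm D q) x y := by
  rw [riemannianEDist]
  rfl

theorem penalisedEDist_self (q : ℕ+) (x : M) : penalisedEDist D q x x = 0 := by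
  rw [penalisedEDist_eq_riemannianEDist]
  exact @riemannianEDist_self E _ _ E _ 𝓘(ℝ, E) M _ _ (penalisedENorm D q)
    (penalisedENorm_smulClass D q) _

theorem penalisedEDist_comm (q : ℕ+) (x y : M) :
    penalisedEDist D q x y = penalisedEDist D q y x := by
  simp only [penalisedEDist_eq_riemannianEDist]
  exact @riemannianEDist_comm E _ _ E _ 𝓘(ℝ, E) M _ _ (penalisedENorm D q)
    (penalisedENorm_smulClass D q) _ _

theorem penalisedEDist_triangle (q : ℕ+) (x y z : M) :
    penalisedEDist D q x z ≤ penalisedEDist D q x y + penalisedEDist D q y z := by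
  simp only [penalisedEDist_eq_riemannianEDist]
  exact @riemannianEDist_triangle E _ _ E _ 𝓘(ℝ, E) M _ _ (penalisedENorm D q)
    (penalisedENorm_smulClass D q) _ _ _

theorem penalisedEDist_le_mul_riemannianEDist (q : ℕ+) (x y : M) :
    penalisedEDist D q x y ≤ ENNReal.ofReal √q * riemannianEDist 𝓘(ℝ, E) x y := by
  have hq : ENNReal.ofReal √(q : ℝ) ≠ 0 := by simp
  rw [riemannianEDist]
  simp only [penalisedEDist, ENNReal.mul_iInf_of_ne hq ENNReal.ofReal_ne_top]
  refine iInf_mono fun γ ↦ iInf_mono fun hγ ↦ ?_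
  rw [← lintegral_const_mul' _ _ ENNReal.ofReal_ne_top]
  refine lintegral_mono fun t ↦ ?_
  rw [← ofReal_norm, ← ENNReal.ofReal_mul (Real.sqrt_nonneg _)]
  refine ENNReal.ofReal_le_ofReal ((Real.sqrt_le_sqrt (penalisedMetric_le D q _ _)).trans_eq ?_)
  rw [Real.sqrt_mul (by positivity), Real.sqrt_sq (norm_nonneg _)]

/-- The supremum over `q` of the penalised distances. It is dominated by the length of horizontal
curves, and is the only sub-Riemannian quantity that matters for the compactness argument. -/
def horizontalEDist (x y : M) : ℝ≥0∞ := ⨆ q : ℕ+, penalisedEDist D q x y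

theorem penalisedEDist_le_horizontalEDist (q : ℕ+) (x y : M) :
    penalisedEDist D q x y ≤ horizontalEDist D x y :=
  le_iSup (fun q : ℕ+ ↦ penalisedEDist D q x y) q

theorem horizontalEDist_self (x : M) : horizontalEDist D x x = 0 := by
  simp [horizontalEDist, penalisedEDist_self]

theorem horizontalEDist_comm (x y : M) : horizontalEDist D x y = horizontalEDist D y x := by
  simp only [horizontalEDist, penalisedEDist_comm D _ x y]

theorem horizontalEDist_triangle (x y z : M) :
    horizontalEDist D x z ≤ horizontalEDist D x y + horizontalEDist D y z :=
  iSup_le fun q ↦ (penalisedEDist_triangle D q x y z).trans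
    (add_le_add (penalisedEDist_le_horizontalEDist D q x y)
      (penalisedEDist_le_horizontalEDist D q y z))

/-- A `C¹` curve tangent to `D` with speed at most `C` has displacement at most `C (b - a)`,
uniformly in `q`: the penalty does not see horizontal directions. -/
theorem horizontalEDist_le_of_horizontal {c : ℝ → M} (hc : ContMDiff 𝓘(ℝ, ℝ) 𝓘(ℝ, E) 1 c)
    (hD : ∀ t, mfderiv 𝓘(ℝ, ℝ) 𝓘(ℝ, E) c t 1 ∈ D (c t)) {C : ℝ}
    (hC : ∀ t, ‖mfderiv 𝓘(ℝ, ℝ) 𝓘(ℝ, E) c t 1‖ ≤ C) {a b : ℝ} (hab : a ≤ b) :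
    horizontalEDist D (c a) (c b) ≤ ENNReal.ofReal (C * (b - a)) := by
  have hC0 : 0 ≤ C := (norm_nonneg _).trans (hC 0)
  refine iSup_le fun q ↦ ?_
  rw [penalisedEDist_eq_riemannianEDist]
  refine (@riemannianEDist_le_pathELength E _ _ E _ 𝓘(ℝ, E) M _ _ (penalisedENorm D q)
    (penalisedENorm_smulClass D q) _ _ a b c hc.contMDiffOn rfl rfl hab).trans ?_
  rw [@pathELength_eq_lintegral_mfderiv_Icc]
  calc ∫⁻ t in Icc a b, ENNReal.ofReal √(penalisedMetric D q (c t)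
        (mfderiv 𝓘(ℝ, ℝ) 𝓘(ℝ, E) c t 1) (mfderiv 𝓘(ℝ, ℝ) 𝓘(ℝ, E) c t 1))
      ≤ ∫⁻ _ in Icc a b, ENNReal.ofReal C := by
        refine lintegral_mono fun t ↦ ENNReal.ofReal_le_ofReal ?_
        rw [penalisedMetric_of_mem D q _ (hD t), Real.sqrt_sq (norm_nonneg _)]
        exact hC t
    _ = ENNReal.ofReal (C * (b - a)) := by
        rw [setLIntegral_const, Real.volume_Icc, ENNReal.ofReal_mul hC0]

/-- The same bound for times in any order. -/
theorem horizontalEDist_le_of_horizontal_abs {c : ℝ → M} (hc : ContMDiff 𝓘(ℝ, ℝ) 𝓘(ℝ, E) 1 c)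
    (hD : ∀ t, mfderiv 𝓘(ℝ, ℝ) 𝓘(ℝ, E) c t 1 ∈ D (c t)) {C : ℝ}
    (hC : ∀ t, ‖mfderiv 𝓘(ℝ, ℝ) 𝓘(ℝ, E) c t 1‖ ≤ C) (a b : ℝ) :
    horizontalEDist D (c a) (c b) ≤ ENNReal.ofReal (C * |b - a|) := by
  rcases le_total a b with h | h
  · rw [abs_of_nonneg (sub_nonneg.2 h)]
    exact horizontalEDist_le_of_horizontal D hc hD hC h
  · rw [horizontalEDist_comm, abs_sub_comm, abs_of_nonneg (sub_nonneg.2 h)]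
    exact horizontalEDist_le_of_horizontal D hc hD hC h

end PenalisedDistance

section LowerSemicontinuity

variable {E : Type*} [NormedAddCommGroup E] [NormedSpace ℝ E] [FiniteDimensional ℝ E]
  {M : Type*} [EMetricSpace M] [ChartedSpace E M]
  [RiemannianBundle (fun x : M ↦ TangentSpace 𝓘(ℝ, E) x)] [IsRiemannianManifold 𝓘(ℝ, E) M]
  (D : ∀ x : M, Submodule ℝ (TangentSpace 𝓘(ℝ, E) x))

/-- Bounds on `horizontalEDist` pass to limits, since every single `d_q` is continuous. -/
theorem horizontalEDist_le_of_tendsto {x y : M} {u : ℕ → M} (hu : Tendsto u atTop (𝓝 y))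
    {L : ℝ≥0∞} (hL : ∀ n, horizontalEDist D x (u n) ≤ L) : horizontalEDist D x y ≤ L := by
  refine iSup_le fun q ↦ ?_
  have h0 : Tendsto (fun n ↦ L + ENNReal.ofReal √q * edist (u n) y) atTop (𝓝 (L + 0)) := by
    refine Tendsto.const_add L ?_
    rw [← mul_zero (ENNReal.ofReal √(q : ℝ))]
    exact ENNReal.Tendsto.const_mul (tendsto_iff_edist_tendsto_0.1 hu)
      (Or.inr ENNReal.ofReal_ne_top)
  rw [add_zero] at h0
  refine ge_of_tendsto' h0 fun n ↦ (penalisedEDist_triangle D q x (u n) y).trans ?_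
  refine add_le_add ((penalisedEDist_le_horizontalEDist D q x _).trans (hL n)) ?_
  rw [IsRiemannianManifold.out (I := 𝓘(ℝ, E)) (u n) y]
  exact penalisedEDist_le_mul_riemannianEDist D q _ _

end LowerSemicontinuity

/-! ### Compactness of equi-Lipschitz paths -/

section EquiLipschitz

open scoped NNReal

variable {X : Type*} [EMetricSpace X] [CompleteSpace X] [LocallyCompactSpace X]

/-- In a complete locally compact space, equi-Lipschitz paths with a common starting point are
pointwise relatively compact. The set of good times is open because a compact set has a compact
neighbourhood, and closed because a set that is approximated by totally bounded sets is totally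
bounded; this replaces the Hopf–Rinow theorem. -/
theorem totallyBounded_range_of_lipschitzWith {ι : Type*} {K : ℝ≥0} {γ : ι → unitInterval → X}
    (hγ : ∀ i, LipschitzWith K (γ i)) {x : X} (h0 : ∀ i, γ i 0 = x) (t : unitInterval) :
    TotallyBounded (range fun i ↦ γ i t) := by
  let s : Set unitInterval := {t | TotallyBounded (range fun i ↦ γ i t)}
  have hnhds (t : unitInterval) {ε : ℝ≥0∞} (hε : 0 < ε) :
      ∀ᶠ t' in 𝓝 t, ∀ i, edist (γ i t') (γ i t) < ε := by
    have h : Tendsto (fun t' ↦ K * edist t' t) (𝓝 t) (𝓝 (K * 0)) :=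
      ENNReal.Tendsto.const_mul (tendsto_iff_edist_tendsto_0.1 tendsto_id)
        (Or.inr ENNReal.coe_ne_top)
    rw [mul_zero] at h
    filter_upwards [h.eventually (gt_mem_nhds hε)] with t' ht' i
    exact (hγ i t' t).trans_lt ht'
  have hopen : IsOpen s := by
    rw [isOpen_iff_mem_nhds]
    intro t ht
    have hc : IsCompact (closure (range fun i ↦ γ i t)) :=
      TotallyBounded.isCompact_of_isClosed (TotallyBounded.closure ht) isClosed_closure
    obtain ⟨K', hK', hsub⟩ := exists_compact_superset hc
    obtain ⟨δ, hδ, hthick⟩ := hc.exists_thickening_subset_open isOpen_interior hsub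
    filter_upwards [hnhds t (ENNReal.ofReal_pos.2 hδ)] with t' ht'
    refine hK'.totallyBounded.subset ?_
    rintro _ ⟨i, rfl⟩
    refine interior_subset (hthick ?_)
    rw [Metric.mem_thickening_iff_exists_edist_lt]
    exact ⟨γ i t, subset_closure ⟨i, rfl⟩, ht' i⟩
  have hclosed : IsClosed s := by
    rw [← isOpen_compl_iff, isOpen_iff_mem_nhds]
    intro t ht
    by_contra hcon
    have hfreq : ∃ᶠ t' in 𝓝 t, t' ∈ s := by
      intro h
      exact hcon (by filter_upwards [h] with t' h' using h')
    refine ht ?_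
    change TotallyBounded _
    rw [EMetric.totallyBounded_iff]
    intro ε hε
    have hε2 : 0 < ε / 2 := ENNReal.half_pos hε.ne'
    obtain ⟨t', ht's, ht'⟩ := (hfreq.and_eventually (hnhds t hε2)).exists
    obtain ⟨F, hF, hcov⟩ := EMetric.totallyBounded_iff.1 ht's (ε / 2) hε2
    refine ⟨F, hF, ?_⟩
    rintro _ ⟨i, rfl⟩
    obtain ⟨y, hy, hiy⟩ := mem_iUnion₂.1 (hcov ⟨i, rfl⟩)
    refine mem_iUnion₂.2 ⟨y, hy, ?_⟩
    have h1 : edist (γ i t') y < ε / 2 := hiy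
    have h2 := edist_triangle_left (γ i t) y (γ i t')
    exact h2.trans_lt ((ENNReal.add_lt_add (ht' i) h1).trans_eq (ENNReal.add_halves ε))
  have huniv : s = univ := by
    refine IsClopen.eq_univ ⟨hclosed, hopen⟩ ⟨0, ?_⟩
    change TotallyBounded _
    simp only [h0]
    exact (finite_range_const).totallyBounded
  exact huniv.symm.subset (mem_univ t)

/-- A sequence of equi-Lipschitz paths with common endpoints has a uniformly convergent
subsequence. -/
theorem exists_subseq_tendstoUniformly_of_lipschitzWith {K : ℝ≥0} {x y : X} {γ : ℕ → Path x y}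
    (hγ : ∀ n, LipschitzWith K (γ n)) :
    ∃ φ : ℕ → ℕ, StrictMono φ ∧
      ∃ γlim : Path x y, TendstoUniformly (fun j t ↦ γ (φ j) t) γlim atTop := by
  let Q : unitInterval → Set X := fun t ↦ closure (range fun n ↦ γ n t)
  have hQ (t : unitInterval) : IsCompact (Q t) :=
    TotallyBounded.isCompact_of_isClosed
      (totallyBounded_range_of_lipschitzWith hγ (fun n ↦ (γ n).source) t).closure isClosed_closure
  let S : Set C(unitInterval, X) := {f | LipschitzWith K f ∧ ∀ t, f t ∈ Q t}
  have hS : IsCompact S := by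
    refine ArzelaAscoli.isCompact_of_equicontinuous S ?_ ?_
    · have : ContinuousMap.toFun '' S = {f | LipschitzWith K f} ∩ univ.pi Q := by
        ext f
        constructor
        · rintro ⟨g, hg, rfl⟩
          exact ⟨hg.1, fun t _ ↦ hg.2 t⟩
        · rintro ⟨h1, h2⟩
          exact ⟨⟨f, h1.continuous⟩, ⟨h1, fun t ↦ h2 t (mem_univ t)⟩, rfl⟩
      rw [this]
      exact (isCompact_univ_pi hQ).inter_left (isClosed_setOfPred_lipschitzWith K)
    · exact (LipschitzWith.uniformEquicontinuous (fun f : S ↦ (f : unitInterval → X)) K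
        fun f ↦ f.2.1).equicontinuous
  have hmem (n : ℕ) : (γ n).toContinuousMap ∈ S :=
    ⟨hγ n, fun t ↦ subset_closure ⟨n, rfl⟩⟩
  obtain ⟨f, -, φ, hφ, hlim⟩ := hS.tendsto_subseq hmem
  have hunif := ContinuousMap.tendsto_iff_tendstoUniformly.1 hlim
  have h0 : f 0 = x := tendsto_nhds_unique (hunif.tendsto_at 0)
    (by simp)
  have h1 : f 1 = y := tendsto_nhds_unique (hunif.tendsto_at 1)
    (by simp)
  exact ⟨φ, hφ, ⟨f, h0, h1⟩, hunif⟩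

end EquiLipschitz

section Geodesics

variable {E : Type*} [NormedAddCommGroup E] [NormedSpace ℝ E]
  {M : Type*} [EMetricSpace M] [ChartedSpace E M]
  [RiemannianBundle (fun x : M ↦ TangentSpace 𝓘(ℝ, E) x)] [IsRiemannianManifold 𝓘(ℝ, E) M]

open scoped NNReal in
/-- A `C¹` path with speed at most `K` is `K`-Lipschitz for the Riemannian distance. -/
theorem lipschitzWith_of_enorm_mfderiv_le {γ : unitInterval → M}
    (hγ : ContMDiff (𝓡∂ 1) 𝓘(ℝ, E) 1 γ) {K : ℝ≥0}
    (hK : ∀ t, ‖mfderiv (𝓡∂ 1) 𝓘(ℝ, E) γ t 1‖ₑ ≤ K) : LipschitzWith K γ := by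
  have key (s t : unitInterval) (hst : s ≤ t) : edist (γ s) (γ t) ≤ K * edist s t := by
    have hst' : (s : ℝ) ≤ t := hst
    have hsub : Icc (s : ℝ) t ⊆ Icc 0 1 := Icc_subset_Icc s.2.1 t.2.2
    have hc : ContMDiffOn 𝓘(ℝ, ℝ) 𝓘(ℝ, E) 1 (γ ∘ projIcc (0 : ℝ) 1 zero_le_one) (Icc s t) :=
      (contMDiffOn_comp_projIcc_iff.2 hγ).mono hsub
    rw [IsRiemannianManifold.out (I := 𝓘(ℝ, E)) (γ s) (γ t)]
    refine (riemannianEDist_le_pathELength hc (by simp) (by simp) hst').trans ?_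
    rw [pathELength_eq_lintegral_mfderiv_Ioo]
    calc ∫⁻ u in Ioo (s : ℝ) t,
          ‖mfderiv 𝓘(ℝ, ℝ) 𝓘(ℝ, E) (γ ∘ projIcc (0 : ℝ) 1 zero_le_one) u 1‖ₑ
        ≤ ∫⁻ _ in Ioo (s : ℝ) t, (K : ℝ≥0∞) := by
          refine setLIntegral_mono measurable_const fun u hu ↦ ?_
          have hu' : u ∈ Ioo (0 : ℝ) 1 := ⟨s.2.1.trans_lt hu.1, hu.2.trans_le t.2.2⟩
          rw [← mfderivWithin_of_mem_nhds (s := Icc (0 : ℝ) 1) (Icc_mem_nhds hu'.1 hu'.2)]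
          have h := mfderivWithin_comp_projIcc_one (I := 𝓘(ℝ, E)) (f := γ)
            (w := (⟨u, hu'.1.le, hu'.2.le⟩ : unitInterval))
          have h2 := hK ⟨u, hu'.1.le, hu'.2.le⟩
          rw [← h] at h2
          -- the base point is `γ (projIcc u)` on one side and `γ u` on the other
          have base {z z' : M} (hz : z = z') (v : E) :
              ‖(show TangentSpace 𝓘(ℝ, E) z from v)‖ₑ =
                ‖(show TangentSpace 𝓘(ℝ, E) z' from v)‖ₑ := by subst hz; rfl
          refine le_trans (le_of_eq (base ?_ _)) h2
          simp [projIcc_of_mem zero_le_one (⟨hu'.1.le, hu'.2.le⟩ : u ∈ Icc (0 : ℝ) 1)]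
      _ = K * edist s t := by
          rw [setLIntegral_const, Real.volume_Ioo, edist_comm, Subtype.edist_eq, edist_dist,
            Real.dist_eq, abs_of_nonneg (sub_nonneg.2 hst')]
  intro s t
  rcases le_total s t with h | h
  · exact key s t h
  · rw [edist_comm, edist_comm s]
    exact key t s h

variable [FiniteDimensional ℝ E]

open scoped NNReal in
/-- A minimising `g_q`-geodesic is Lipschitz for `g`, with constant any bound on `d_q`: its
`g_q`-speed is the constant `d_q(x, y)`, and `g ≤ g_q`. -/
theorem IsMinimisingGeodesic.lipschitzWith
    {D : ∀ x : M, Submodule ℝ (TangentSpace 𝓘(ℝ, E) x)} {q : ℕ+} {x y : M} {γ : Path x y}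
    (hγ : IsMinimisingGeodesic D q γ) {K : ℝ≥0} (hK : penalisedEDist D q x y ≤ K) :
    LipschitzWith K γ := by
  obtain ⟨c, hc⟩ := hγ.constant_speed
  have hlen : ENNReal.ofReal √c ≤ K := by
    refine le_trans (le_of_eq ?_) (hγ.length_eq.trans_le hK)
    simp [penalisedLength, hc]
  refine lipschitzWith_of_enorm_mfderiv_le hγ.contMDiff fun t ↦ le_trans ?_ hlen
  rw [← ofReal_norm]
  refine ENNReal.ofReal_le_ofReal (Real.le_sqrt_of_sq_le ?_)
  rw [← hc t]
  exact norm_sq_le_penalisedMetric D q _ _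

/-- Minimising geodesics of the penalised metrics subconverge as soon as the penalised distances
between their endpoints stay bounded. -/
theorem exists_subseq_of_horizontalEDist_ne_top [CompleteSpace M]
    (D : ∀ x : M, Submodule ℝ (TangentSpace 𝓘(ℝ, E) x)) {x y : M}
    (hxy : horizontalEDist D x y ≠ ⊤) (γ : ℕ+ → Path x y)
    (hγ : ∀ q : ℕ+, IsMinimisingGeodesic D q (γ q)) :
    ∃ φ : ℕ → ℕ+, StrictMono φ ∧
      ∃ γlim : Path x y, TendstoUniformly (fun j t ↦ γ (φ j) t) γlim atTop := by
  have : LocallyCompactSpace M := ChartedSpace.locallyCompactSpace E M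
  have hlip (n : ℕ) : LipschitzWith (horizontalEDist D x y).toNNReal (γ n.succPNat) := by
    refine (hγ _).lipschitzWith ?_
    rw [ENNReal.coe_toNNReal hxy]
    exact penalisedEDist_le_horizontalEDist D _ x y
  obtain ⟨φ, hφ, γlim, hlim⟩ :=
    exists_subseq_tendstoUniformly_of_lipschitzWith (γ := fun n ↦ γ n.succPNat) hlip
  exact ⟨fun j ↦ (φ j).succPNat, fun a b hab ↦ Nat.succPNat_lt_succPNat.2 (hφ hab), γlim, hlim⟩

end Geodesics

/-! ### Vector fields as operators and asymptotic expansions -/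

section Operators

variable {E : Type*} [NormedAddCommGroup E] [NormedSpace ℝ E]

variable (E) in
/-- The space of smooth maps `E → E`, on which vector fields act as operators. Vector-valued maps
are used so that the identity is among them. -/
def smoothMaps : Submodule ℝ (E → E) where
  carrier := {f | ContDiff ℝ ∞ f}
  add_mem' {f g} (hf : ContDiff ℝ ∞ f) (hg : ContDiff ℝ ∞ g) :=
    show ContDiff ℝ ∞ (f + g) from hf.add hg
  zero_mem' := show ContDiff ℝ ∞ (fun _ ↦ (0 : E)) from contDiff_const
  smul_mem' c f (hf : ContDiff ℝ ∞ f) := show ContDiff ℝ ∞ (c • f) from hf.const_smul c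

/-- The operator `f ↦ V f` of differentiation along the smooth vector field `V`. -/
def lieDerivative (V : E → E) (hV : ContDiff ℝ ∞ V) : Module.End ℝ (smoothMaps E) where
  toFun f := ⟨fun p ↦ fderiv ℝ (f : E → E) p (V p), by
    have hf : ContDiff ℝ ∞ (f : E → E) := f.2
    exact (hf.fderiv_right (m := ∞) (by simp)).clm_apply hV⟩
  map_add' f g := by
    have hf : ContDiff ℝ ∞ (f : E → E) := f.2
    have hg : ContDiff ℝ ∞ (g : E → E) := g.2
    ext p
    simp only [Submodule.coe_add, Pi.add_apply]
    rw [fderiv_add (hf.differentiable (by simp) p) (hg.differentiable (by simp) p)]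
    rfl
  map_smul' c f := by
    have hf : ContDiff ℝ ∞ (f : E → E) := f.2
    ext p
    simp only [Submodule.coe_smul, RingHom.id_apply, Pi.smul_apply]
    rw [fderiv_const_smul (hf.differentiable (by simp) p)]
    rfl

theorem lieDerivative_apply (V : E → E) (hV : ContDiff ℝ ∞ V) (f : smoothMaps E) (p : E) :
    (lieDerivative V hV f : E → E) p = fderiv ℝ (f : E → E) p (V p) := rfl

theorem contDiff_lieBracket {V W : E → E} (hV : ContDiff ℝ ∞ V) (hW : ContDiff ℝ ∞ W) :
    ContDiff ℝ ∞ (VectorField.lieBracket ℝ V W) := by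
  rw [VectorField.lieBracket_eq]
  exact ((hW.fderiv_right (m := ∞) (by simp)).clm_apply hV).sub
    ((hV.fderiv_right (m := ∞) (by simp)).clm_apply hW)

/-- The Lie bracket of vector fields is the commutator of the operators they define. -/
theorem lieDerivative_lieBracket {V W : E → E} (hV : ContDiff ℝ ∞ V) (hW : ContDiff ℝ ∞ W) :
    lieDerivative (VectorField.lieBracket ℝ V W) (contDiff_lieBracket hV hW) =
      lieDerivative V hV * lieDerivative W hW - lieDerivative W hW * lieDerivative V hV := by
  ext f p
  have hf : ContDiff ℝ ∞ (f : E → E) := f.2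
  have hf' : Differentiable ℝ (fderiv ℝ (f : E → E)) :=
    (hf.fderiv_right (m := ∞) (by simp)).differentiable (by simp)
  have key {X : E → E} (hX : ContDiff ℝ ∞ X) (v : E) :
      fderiv ℝ (fun p ↦ fderiv ℝ (f : E → E) p (X p)) p v =
        fderiv ℝ (fderiv ℝ (f : E → E)) p v (X p) + fderiv ℝ (f : E → E) p (fderiv ℝ X p v) := by
    rw [fderiv_clm_apply (hf' p) (hX.differentiable (by simp) p)]
    simp [add_comm]
  have hsymm : fderiv ℝ (fderiv ℝ (f : E → E)) p (V p) (W p) =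
      fderiv ℝ (fderiv ℝ (f : E → E)) p (W p) (V p) :=
    (hf.contDiffAt.isSymmSndFDerivAt (by
      rw [minSmoothness_of_isRCLikeNormedField]; exact WithTop.coe_le_coe.2 le_top)).eq _ _
  change fderiv ℝ (f : E → E) p (VectorField.lieBracket ℝ V W p) =
    fderiv ℝ (fun p ↦ fderiv ℝ (f : E → E) p (W p)) p (V p) -
      fderiv ℝ (fun p ↦ fderiv ℝ (f : E → E) p (V p)) p (W p)
  rw [key hV, key hW, hsymm, VectorField.lieBracket, map_sub]
  abel

/-- The family of maps `m t : E → E` has the operator-valued formal power series `A` as asymptotic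
expansion at `t = 0`: `f ∘ m t = ∑ tʲ A_j f + O(t^(N+1))` uniformly on `E`, for all smooth `f`. -/
def HasExpansion (m : ℝ → E → E) (A : PowerSeries (Module.End ℝ (smoothMaps E))) : Prop :=
  ∀ (f : smoothMaps E) (N : ℕ), ∃ C : ℝ, ∀ t : ℝ, |t| ≤ 1 → ∀ p : E,
    ‖(f : E → E) (m t p) -
      ∑ j ∈ Finset.range (N + 1), t ^ j • (PowerSeries.coeff j A f : E → E) p‖ ≤ C * |t| ^ (N + 1)

/-- Composition of families of maps corresponds to the product of expansions; the map that is
applied first gives the left factor, because functions are pulled back. -/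
theorem HasExpansion.comp {m₁ m₂ : ℝ → E → E}
    {A₁ A₂ : PowerSeries (Module.End ℝ (smoothMaps E))}
    (h₁ : HasExpansion m₁ A₁) (h₂ : HasExpansion m₂ A₂) :
    HasExpansion (fun t p ↦ m₂ t (m₁ t p)) (A₁ * A₂) := by
  intro f N
  obtain ⟨C, hC⟩ := h₂ f N
  choose C' hC' using fun j : ℕ ↦ h₁ (PowerSeries.coeff j A₂ f) (N - j)
  refine ⟨C + ∑ j ∈ Finset.range (N + 1), C' j, fun t ht p ↦ ?_⟩
  have hsum : ∑ n ∈ Finset.range (N + 1), t ^ n • (PowerSeries.coeff n (A₁ * A₂) f : E → E) p =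
      ∑ j ∈ Finset.range (N + 1), t ^ j • ∑ i ∈ Finset.range (N - j + 1),
        t ^ i • (PowerSeries.coeff i A₁ (PowerSeries.coeff j A₂ f) : E → E) p := by
    have h := Finset.sum_range_diag_flip (N + 1) fun j i ↦
      t ^ j • t ^ i • (PowerSeries.coeff i A₁ (PowerSeries.coeff j A₂ f) : E → E) p
    calc _ = ∑ n ∈ Finset.range (N + 1), ∑ k ∈ Finset.range (n + 1), t ^ k • t ^ (n - k) •
          (PowerSeries.coeff (n - k) A₁ (PowerSeries.coeff k A₂ f) : E → E) p := by
          refine Finset.sum_congr rfl fun n _ ↦ ?_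
          rw [PowerSeries.coeff_mul, ← Finset.Nat.sum_antidiagonal_swap,
            Finset.Nat.sum_antidiagonal_eq_sum_range_succ_mk]
          simp only [LinearMap.sum_apply, Submodule.coe_sum, Finset.sum_apply, Finset.smul_sum]
          refine Finset.sum_congr rfl fun k hk ↦ ?_
          rw [smul_smul, ← pow_add,
            Nat.add_sub_cancel' (Nat.lt_succ_iff.1 (Finset.mem_range.1 hk))]
          rfl
      _ = _ := by
          rw [h]
          refine Finset.sum_congr rfl fun j hj ↦ ?_
          rw [Finset.smul_sum, Nat.sub_add_comm (Nat.lt_succ_iff.1 (Finset.mem_range.1 hj))]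
  have hsplit : (f : E → E) (m₂ t (m₁ t p)) -
      ∑ n ∈ Finset.range (N + 1), t ^ n • (PowerSeries.coeff n (A₁ * A₂) f : E → E) p =
      ((f : E → E) (m₂ t (m₁ t p)) -
        ∑ j ∈ Finset.range (N + 1), t ^ j • (PowerSeries.coeff j A₂ f : E → E) (m₁ t p)) +
      ∑ j ∈ Finset.range (N + 1), t ^ j • ((PowerSeries.coeff j A₂ f : E → E) (m₁ t p) -
        ∑ i ∈ Finset.range (N - j + 1),
          t ^ i • (PowerSeries.coeff i A₁ (PowerSeries.coeff j A₂ f) : E → E) p) := by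
    rw [hsum]
    simp only [smul_sub, Finset.sum_sub_distrib]
    abel
  rw [hsplit, add_mul, Finset.sum_mul]
  refine (norm_add_le _ _).trans (add_le_add (hC t ht _) ((norm_sum_le _ _).trans ?_))
  refine Finset.sum_le_sum fun j hj ↦ ?_
  have hj' : j ≤ N := Nat.lt_succ_iff.1 (Finset.mem_range.1 hj)
  rw [norm_smul, norm_pow, Real.norm_eq_abs]
  calc |t| ^ j * _ ≤ |t| ^ j * (C' j * |t| ^ (N - j + 1)) := by
        gcongr
        exact hC' j t ht p
    _ = C' j * |t| ^ (N + 1) := by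
        have : |t| ^ (N + 1) = |t| ^ j * |t| ^ (N - j + 1) := by
          rw [← pow_add]; congr 1; omega
        rw [this]; ring

end Operators

section FormalExponential

open Nat in
/-- The formal exponential `∑ (Xⁿ / n!) aⁿ` of an element of a possibly noncommutative algebra. -/
def formalExp {R : Type*} [Ring R] [Algebra ℝ R] (a : R) : PowerSeries R :=
  PowerSeries.mk fun n ↦ ((n ! : ℝ)⁻¹) • a ^ n

theorem formalExp_mul_formalExp_neg {R : Type*} [Ring R] [Algebra ℝ R] (a : R) :
    formalExp a * formalExp (-a) = 1 := by
  ext n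
  have hcomm : Commute a (-a) := (Commute.refl a).neg_right
  have h := hcomm.add_pow' n
  rw [add_neg_cancel] at h
  rw [PowerSeries.coeff_mul, PowerSeries.coeff_one]
  have h2 : ∑ ij ∈ Finset.HasAntidiagonal.antidiagonal n,
      PowerSeries.coeff ij.1 (formalExp a) * PowerSeries.coeff ij.2 (formalExp (-a)) =
      ((n.factorial : ℝ)⁻¹) • ∑ ij ∈ Finset.HasAntidiagonal.antidiagonal n,
        n.choose ij.1 • (a ^ ij.1 * (-a) ^ ij.2) := by
    rw [Finset.smul_sum]
    refine Finset.sum_congr rfl fun ij hij ↦ ?_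
    have hn := Finset.HasAntidiagonal.mem_antidiagonal.1 hij
    simp only [formalExp, PowerSeries.coeff_mk]
    rw [smul_mul_smul_comm, ← Nat.cast_smul_eq_nsmul ℝ, smul_smul]
    congr 1
    have hc : ((n.choose ij.1 : ℝ)) * ij.1.factorial * ij.2.factorial = n.factorial := by
      have h := Nat.choose_mul_factorial_mul_factorial (Nat.le.intro hn)
      rw [← hn, Nat.add_sub_cancel_left, hn] at h
      exact_mod_cast h
    rw [← hc]
    have hpos : (n.choose ij.1 : ℝ) ≠ 0 := by
      have := Nat.choose_pos (Nat.le.intro hn)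
      positivity
    field_simp
  rw [h2, ← h]
  rcases Nat.eq_zero_or_pos n with rfl | hn
  · simp
  · simp [zero_pow hn.ne', hn.ne']

theorem formalExp_neg_mul_formalExp {R : Type*} [Ring R] [Algebra ℝ R] (a : R) :
    formalExp (-a) * formalExp a = 1 := by
  simpa using formalExp_mul_formalExp_neg (-a)

theorem formalExp_eq {R : Type*} [Ring R] [Algebra ℝ R] (a : R) :
    ∃ u : PowerSeries R, formalExp a = 1 + u * PowerSeries.X ∧ PowerSeries.constantCoeff u = a := by
  refine ⟨PowerSeries.mk fun n ↦ PowerSeries.coeff (n + 1) (formalExp a), ?_, ?_⟩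
  · conv_lhs => rw [PowerSeries.eq_shift_mul_X_add_const (formalExp a)]
    rw [add_comm]
    congr 1
    simp [formalExp, PowerSeries.constantCoeff_mk]
  · simp [formalExp, PowerSeries.constantCoeff_mk]

end FormalExponential

/-! ### Flows, near-identity motions and their commutators -/

section Flows

variable {E : Type*} [NormedAddCommGroup E] [NormedSpace ℝ E]

/-- A compactly supported smooth vector field has integral curves defined for all time. -/
theorem exists_integralCurve_of_hasCompactSupport [FiniteDimensional ℝ E] {V : E → E}
    (hV : ContDiff ℝ ∞ V) (hc : HasCompactSupport V) (p : E) :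
    ∃ c : ℝ → E, c 0 = p ∧ ∀ t, HasDerivAt c (V (c t)) t := by
  obtain ⟨K, hK⟩ := hV.lipschitzWith_of_hasCompactSupport hc (by simp)
  obtain ⟨B, hB⟩ := hc.exists_bound_of_continuous hV.continuous
  have hv : ContMDiff 𝓘(ℝ, E) 𝓘(ℝ, E).tangent 1
      (fun x ↦ (⟨x, V x⟩ : TangentBundle 𝓘(ℝ, E) E)) := fun x ↦
    contMDiffAt_vectorSpace_iff_contDiffAt.2 (hV.of_le (by exact_mod_cast le_top)).contDiffAt
  obtain ⟨c, hc0, hc⟩ := exists_isMIntegralCurve_of_isMIntegralCurveOn (v := V) hv one_pos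
    (fun x ↦ by
      have hPL : IsPicardLindelof (fun _ ↦ V) (tmin := -1) (tmax := 1)
          ⟨0, by simp⟩ x B.toNNReal 0 B.toNNReal K :=
        { lipschitzOnWith := fun _ _ ↦ hK.lipschitzOnWith
          continuousOn := fun _ _ ↦ continuousOn_const
          norm_le := fun _ _ y _ ↦ (hB y).trans (Real.le_coe_toNNReal B)
          mul_max_le := by simp }
      obtain ⟨α, hα0, hα⟩ := hPL.exists_eq_forall_mem_Icc_hasDerivWithinAt₀
      refine ⟨α, hα0, fun t ht ↦ ?_⟩
      have h : HasDerivWithinAt α (V (α t)) (Ioo (-1) 1) t :=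
        (hα t (Ioo_subset_Icc_self ht)).mono Ioo_subset_Icc_self
      exact h.hasFDerivWithinAt.hasMFDerivWithinAt) p
  refine ⟨c, hc0, fun t ↦ ?_⟩
  have h : HasFDerivAt c ((1 : ℝ →L[ℝ] ℝ).smulRight (V (c t)) : ℝ →L[ℝ] E) t := (hc t).hasFDerivAt
  exact h.hasDerivAt.congr_deriv (one_smul ℝ (V (c t)))

/-- An integral curve that starts outside the support of the vector field does not move; hence one
that starts in a set containing the support never leaves that set. -/
theorem integralCurve_mem_of_tsupport_subset {V : E → E} {K : NNReal} (hV : LipschitzWith K V)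
    {Ω : Set E} (hΩ : tsupport V ⊆ Ω) {c : ℝ → E} (hc : ∀ t, HasDerivAt c (V (c t)) t)
    (h0 : c 0 ∈ Ω) (t : ℝ) : c t ∈ Ω := by
  by_cases ht : c t ∈ tsupport V
  · exact hΩ ht
  · have hz : V (c t) = 0 := image_eq_zero_of_notMem_tsupport ht
    have hconst : c = fun _ ↦ c t :=
      ODE_solution_unique_univ (v := fun _ ↦ V) (s := fun _ ↦ univ) (K := K) (t₀ := t)
        (fun _ ↦ hV.lipschitzOnWith) (fun s ↦ ⟨hc s, mem_univ _⟩)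
        (fun s ↦ ⟨by simpa [hz] using hasDerivAt_const s (c t), mem_univ _⟩) rfl
    rw [← congrFun hconst 0]
    exact h0

theorem lieDerivative_neg {V : E → E} (hV : ContDiff ℝ ∞ V) :
    lieDerivative (fun p ↦ -V p) hV.neg = -lieDerivative V hV := by
  ext f p
  simp [lieDerivative_apply]

/-- Taylor's formula along the flow: the flow of `V` has the formal exponential of the operator
`V` as its expansion. -/
theorem hasExpansion_flow {V : E → E} (hV : ContDiff ℝ ∞ V) (hc : HasCompactSupport V)
    {Φ : ℝ → E → E} (h0 : ∀ p, Φ 0 p = p) (hΦ : ∀ t p, HasDerivAt (fun s ↦ Φ s p) (V (Φ t p)) t) :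
    HasExpansion Φ (formalExp (lieDerivative V hV)) := by
  set L := lieDerivative V hV with hL
  have hderiv (f : smoothMaps E) (p : E) (t : ℝ) :
      HasDerivAt (fun s ↦ (f : E → E) (Φ s p)) ((L f : E → E) (Φ t p)) t := by
    have hf : ContDiff ℝ ∞ (f : E → E) := f.2
    exact (hf.differentiable (by simp) (Φ t p)).hasFDerivAt.comp_hasDerivAt t (hΦ t p)
  -- the mean value inequality on the segment from `0` to `t`
  have mvt (h h' : ℝ → E) (t C : ℝ) (hh : ∀ s, HasDerivAt h (h' s) s)
      (hC : ∀ s ∈ uIcc 0 t, ‖h' s‖ ≤ C) : ‖h t - h 0‖ ≤ C * |t| := by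
    have := (convex_uIcc (0 : ℝ) t).norm_image_sub_le_of_norm_hasDerivWithin_le
      (fun s _ ↦ (hh s).hasDerivWithinAt) hC left_mem_uIcc right_mem_uIcc
    simpa using this
  have hcoeff (f : smoothMaps E) (j : ℕ) (p : E) :
      (PowerSeries.coeff j (formalExp L) f : E → E) p =
        ((j.factorial : ℝ)⁻¹) • ((L ^ j) f : E → E) p := by
    simp [formalExp]
  have main (N : ℕ) : ∀ f : smoothMaps E, ∃ C : ℝ, ∀ t p,
      ‖(f : E → E) (Φ t p) - ∑ j ∈ Finset.range (N + 1),
        t ^ j • (PowerSeries.coeff j (formalExp L) f : E → E) p‖ ≤ C * |t| ^ (N + 1) := by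
    induction N with
    | zero =>
      intro f
      have hsupp : HasCompactSupport (L f : E → E) := by
        refine hc.mono fun p hp ↦ ?_
        contrapose! hp
        simp only [Function.mem_support, not_not] at hp ⊢
        rw [hL, lieDerivative_apply, hp, map_zero]
      have hcont : Continuous (L f : E → E) :=
        (show ContDiff ℝ ∞ (L f : E → E) from (L f).2).continuous
      obtain ⟨C, hC⟩ := hsupp.exists_bound_of_continuous hcont
      refine ⟨C, fun t p ↦ ?_⟩
      have := mvt _ _ t C (hderiv f p) fun s _ ↦ hC _
      simpa [hcoeff, h0] using this
    | succ N ih =>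
      intro f
      obtain ⟨C, hC⟩ := ih (L f)
      have hC0 : 0 ≤ C := by
        have := (norm_nonneg _).trans (hC 1 0)
        simpa using this
      refine ⟨C, fun t p ↦ ?_⟩
      have hpoly (s : ℝ) : HasDerivAt
          (fun s ↦ ∑ j ∈ Finset.range (N + 1 + 1),
            s ^ j • (PowerSeries.coeff j (formalExp L) f : E → E) p)
          (∑ j ∈ Finset.range (N + 1),
            s ^ j • (PowerSeries.coeff j (formalExp L) (L f) : E → E) p) s := by
        simp only [Finset.sum_range_succ' _ (N + 1), pow_zero, one_smul]
        refine HasDerivAt.add_const _ (HasDerivAt.fun_sum fun j _ ↦ ?_)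
        have h := (hasDerivAt_pow (j + 1) s).smul_const
          ((PowerSeries.coeff (j + 1) (formalExp L) f : E → E) p)
        refine h.congr_deriv ?_
        rw [hcoeff, hcoeff, pow_succ L j, smul_smul, smul_smul, Nat.factorial_succ]
        simp only [Nat.add_sub_cancel, Module.End.mul_apply]
        congr 1
        have : (j.factorial : ℝ) ≠ 0 := by positivity
        push_cast
        field_simp
      have := mvt _ _ t (C * |t| ^ (N + 1)) (fun s ↦ (hderiv f p s).sub (hpoly s)) fun s hs ↦ by
        refine (hC s p).trans ?_
        have : |s| ≤ |t| := by simpa using abs_sub_left_of_mem_uIcc hs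
        gcongr
      have hz : ∑ j ∈ Finset.range (N + 1 + 1),
          (0 : ℝ) ^ j • (PowerSeries.coeff j (formalExp L) f : E → E) p = (f : E → E) p := by
        rw [Finset.sum_range_succ']
        simp only [hcoeff]
        simp
      simp only [Pi.sub_apply, h0, hz, sub_self, sub_zero] at this
      rw [pow_succ |t| (N + 1), ← mul_assoc]
      exact this
  intro f N
  obtain ⟨C, hC⟩ := main N f
  exact ⟨C, fun t _ p ↦ hC t p⟩

end Flows

section NearIdentityPowerSeries

variable {R : Type*} [Ring R] {k l : ℕ} {P P' Q Q' U W : PowerSeries R}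

theorem constantCoeff_eq_one_of_eq_one_add (hk : 1 ≤ k) (hP : P = 1 + U * PowerSeries.X ^ k) :
    PowerSeries.constantCoeff P = 1 := by
  simp [hP, Nat.one_le_iff_ne_zero.1 hk]

/-- The inverse of `1 + u Xᵏ + ⋯` is `1 - u Xᵏ + ⋯`. -/
theorem inverse_eq_one_add (hk : 1 ≤ k) (hPP' : P * P' = 1) (hP : P = 1 + U * PowerSeries.X ^ k) :
    P' = 1 + -(U * P') * PowerSeries.X ^ k ∧
      PowerSeries.constantCoeff (-(U * P')) = -PowerSeries.constantCoeff U := by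
  have h0 : PowerSeries.constantCoeff P' = 1 := by
    simpa [constantCoeff_eq_one_of_eq_one_add hk hP] using
      congrArg PowerSeries.constantCoeff hPP'
  have h1 : P' + U * PowerSeries.X ^ k * P' = 1 := by
    rw [← hPP', hP, add_mul, one_mul]
  have h2 : U * PowerSeries.X ^ k * P' = U * P' * PowerSeries.X ^ k := by
    rw [mul_assoc, PowerSeries.X_pow_mul, mul_assoc]
  refine ⟨?_, by simp [h0]⟩
  rw [neg_mul, ← h2, ← h1]
  abel

/-- `A = 1 + L Xᵏ + ⋯` is invertible with inverse `A'`. -/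
def IsNearIdentity (k : ℕ) (L : R) (A A' : PowerSeries R) : Prop :=
  A * A' = 1 ∧ A' * A = 1 ∧
    ∃ U : PowerSeries R, A = 1 + U * PowerSeries.X ^ k ∧ PowerSeries.constantCoeff U = L

theorem IsNearIdentity.symm (hk : 1 ≤ k) {L : R} (h : IsNearIdentity k L P P') :
    IsNearIdentity k (-L) P' P := by
  obtain ⟨h1, h2, U, hU, rfl⟩ := h
  exact ⟨h2, h1, _, inverse_eq_one_add hk h1 hU⟩

theorem isNearIdentity_formalExp [Algebra ℝ R] (a : R) :
    IsNearIdentity 1 a (formalExp a) (formalExp (-a)) := by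
  obtain ⟨U, hU, hU0⟩ := formalExp_eq a
  exact ⟨formalExp_mul_formalExp_neg a, formalExp_neg_mul_formalExp a, U, by rwa [pow_one], hU0⟩

theorem IsNearIdentity.coeff_eq_zero {L : R} (h : IsNearIdentity k L P P') {j : ℕ} (hj : 0 < j)
    (hjk : j < k) : PowerSeries.coeff j P = 0 := by
  obtain ⟨-, -, U, rfl, -⟩ := h
  simp [PowerSeries.coeff_mul_X_pow', PowerSeries.coeff_one, hj.ne', not_le.2 hjk]

theorem IsNearIdentity.coeff_zero_eq (hk : 1 ≤ k) {L : R} (h : IsNearIdentity k L P P') :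
    PowerSeries.coeff 0 P = 1 := by
  obtain ⟨-, -, U, rfl, -⟩ := h
  simp [Nat.one_le_iff_ne_zero.1 hk]

theorem IsNearIdentity.coeff_eq (hk : 1 ≤ k) {L : R} (h : IsNearIdentity k L P P') :
    PowerSeries.coeff k P = L := by
  obtain ⟨-, -, U, rfl, rfl⟩ := h
  simp [PowerSeries.coeff_mul_X_pow', PowerSeries.coeff_one, Nat.one_le_iff_ne_zero.1 hk]

theorem commutator_mul_swap {R : Type*} [Ring R] {P P' Q Q' : R} (hP : P' * P = 1)
    (hQ : Q' * Q = 1) (hP' : P * P' = 1) (hQ' : Q * Q' = 1) :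
    P * Q * P' * Q' * (Q * P * Q' * P') = 1 := by
  calc P * Q * P' * Q' * (Q * P * Q' * P') = P * Q * P' * (Q' * Q) * P * Q' * P' := by
        simp only [mul_assoc]
    _ = P * Q * (P' * P) * Q' * P' := by rw [hQ]; simp only [mul_assoc, mul_one]
    _ = P * (Q * Q') * P' := by rw [hP]; simp only [mul_assoc, mul_one]
    _ = 1 := by rw [hQ', mul_one, hP']

/-- The group commutator of `1 + u Xᵏ + ⋯` and `1 + w Xˡ + ⋯` is `1 + (u w - w u) Xᵏ⁺ˡ + ⋯`. -/
theorem commutator_eq_one_add (hk : 1 ≤ k) (hl : 1 ≤ l) (hPP' : P * P' = 1) (hQQ' : Q * Q' = 1)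
    (hP : P = 1 + U * PowerSeries.X ^ k) (hQ : Q = 1 + W * PowerSeries.X ^ l) :
    P * Q * P' * Q' = 1 + (U * W - W * U) * P' * Q' * PowerSeries.X ^ (k + l) ∧
      PowerSeries.constantCoeff ((U * W - W * U) * P' * Q') =
        PowerSeries.constantCoeff U * PowerSeries.constantCoeff W -
          PowerSeries.constantCoeff W * PowerSeries.constantCoeff U := by
  have hP0 : PowerSeries.constantCoeff P' = 1 := by
    simpa [constantCoeff_eq_one_of_eq_one_add hk hP] using
      congrArg PowerSeries.constantCoeff hPP'
  have hQ0 : PowerSeries.constantCoeff Q' = 1 := by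
    simpa [constantCoeff_eq_one_of_eq_one_add hl hQ] using
      congrArg PowerSeries.constantCoeff hQQ'
  have hcomm : P * Q - Q * P = (U * W - W * U) * PowerSeries.X ^ (k + l) := by
    have h1 : U * PowerSeries.X ^ k * (W * PowerSeries.X ^ l) =
        U * W * PowerSeries.X ^ (k + l) := by
      rw [mul_assoc, ← mul_assoc (PowerSeries.X ^ k), PowerSeries.X_pow_mul, pow_add]
      simp only [mul_assoc]
    have h2 : W * PowerSeries.X ^ l * (U * PowerSeries.X ^ k) =
        W * U * PowerSeries.X ^ (k + l) := by
      rw [mul_assoc, ← mul_assoc (PowerSeries.X ^ l), PowerSeries.X_pow_mul, add_comm k, pow_add]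
      simp only [mul_assoc]
    rw [sub_mul, ← h1, ← h2, hP, hQ]
    noncomm_ring
  refine ⟨?_, by simp [hP0, hQ0]⟩
  have h1 : Q * P * P' * Q' = 1 := by rw [mul_assoc Q, hPP', mul_one, hQQ']
  have h2 : (U * W - W * U) * P' * Q' * PowerSeries.X ^ (k + l) =
      (U * W - W * U) * PowerSeries.X ^ (k + l) * P' * Q' := by
    rw [← PowerSeries.X_pow_mul (φ := U * W - W * U), ← PowerSeries.X_pow_mul]
    simp only [mul_assoc]
  rw [h2, ← hcomm, sub_mul, sub_mul, h1]
  abel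

theorem IsNearIdentity.commutator (hk : 1 ≤ k) (hl : 1 ≤ l) {L L' : R}
    (h : IsNearIdentity k L P P') (h' : IsNearIdentity l L' Q Q') :
    IsNearIdentity (k + l) (L * L' - L' * L) (P * Q * P' * Q') (Q * P * Q' * P') := by
  obtain ⟨h1, h2, U, hU, rfl⟩ := h
  obtain ⟨h1', h2', W, hW, rfl⟩ := h'
  exact ⟨commutator_mul_swap h2 h2' h1 h1', commutator_mul_swap h2' h2 h1' h1, _,
    commutator_eq_one_add hk hl h1 h1' hU hW⟩

end NearIdentityPowerSeries

section Realization

variable {E : Type*} [NormedAddCommGroup E] [NormedSpace ℝ E]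

/-- The operator `L` is realised at order `k` by motions in `Ω` of small cost, where `d` measures
the cost: there is a family of motions with cost `O(t)` whose expansion is `1 + tᵏ L + O(tᵏ⁺¹)`,
and a second family with the inverse expansion. -/
def IsRealized (d : E → E → ℝ≥0∞) (Ω : Set E) (k : ℕ) (L : Module.End ℝ (smoothMaps E)) : Prop :=
  ∃ (m m' : ℝ → E → E) (A A' : PowerSeries (Module.End ℝ (smoothMaps E))) (C : ℝ), 0 ≤ C ∧
    HasExpansion m A ∧ HasExpansion m' A' ∧ IsNearIdentity k L A A' ∧
    ∀ t, ∀ p ∈ Ω, (m t p ∈ Ω ∧ d p (m t p) ≤ ENNReal.ofReal (C * |t|)) ∧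
      (m' t p ∈ Ω ∧ d p (m' t p) ≤ ENNReal.ofReal (C * |t|))

/-- A compactly supported vector field is realised at order `1` by its flow. -/
theorem isRealized_of_flow [FiniteDimensional ℝ E] {d : E → E → ℝ≥0∞} {Ω : Set E} {V : E → E}
    (hV : ContDiff ℝ ∞ V) (hc : HasCompactSupport V) {C : ℝ} (hC : 0 ≤ C)
    (hd : ∀ c : ℝ → E, (∀ t, HasDerivAt c (V (c t)) t) → c 0 ∈ Ω →
      ∀ t, c t ∈ Ω ∧ d (c 0) (c t) ≤ ENNReal.ofReal (C * |t|)) :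
    IsRealized d Ω 1 (lieDerivative V hV) := by
  choose c hc0 hcV using exists_integralCurve_of_hasCompactSupport hV hc
  refine ⟨fun t p ↦ c p t, fun t p ↦ c p (-t), formalExp (lieDerivative V hV),
    formalExp (-lieDerivative V hV), C, hC,
    hasExpansion_flow hV hc hc0 fun t p ↦ hcV p t, ?_, isNearIdentity_formalExp _,
    fun t p hp ↦ ⟨?_, ?_⟩⟩
  · rw [← lieDerivative_neg hV]
    refine hasExpansion_flow hV.neg hc.neg (by simpa using hc0) fun t p ↦ ?_
    have h := (hcV p (-t)).scomp t (hasDerivAt_neg t)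
    simpa [Function.comp_def] using h
  · have h := hd (c p) (hcV p) (by rwa [hc0 p]) t
    rwa [hc0 p] at h
  · have h := hd (c p) (hcV p) (by rwa [hc0 p]) (-t)
    rwa [hc0 p, abs_neg] at h

omit [NormedAddCommGroup E] [NormedSpace ℝ E] in
theorem motion_comp_cost {d : E → E → ℝ≥0∞} (htri : ∀ p q r, d p r ≤ d p q + d q r) {Ω : Set E}
    {m₁ m₂ : ℝ → E → E} {C₁ C₂ : ℝ} (hC₁ : 0 ≤ C₁) (hC₂ : 0 ≤ C₂)
    (h₁ : ∀ t, ∀ p ∈ Ω, m₁ t p ∈ Ω ∧ d p (m₁ t p) ≤ ENNReal.ofReal (C₁ * |t|))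
    (h₂ : ∀ t, ∀ p ∈ Ω, m₂ t p ∈ Ω ∧ d p (m₂ t p) ≤ ENNReal.ofReal (C₂ * |t|)) :
    ∀ t, ∀ p ∈ Ω, m₂ t (m₁ t p) ∈ Ω ∧
      d p (m₂ t (m₁ t p)) ≤ ENNReal.ofReal ((C₁ + C₂) * |t|) := by
  intro t p hp
  obtain ⟨hm, hd⟩ := h₁ t p hp
  obtain ⟨hm', hd'⟩ := h₂ t _ hm
  refine ⟨hm', (htri _ _ _).trans ((add_le_add hd hd').trans_eq ?_)⟩
  rw [← ENNReal.ofReal_add (by positivity) (by positivity), add_mul]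

/-- The commutator `P Q P⁻¹ Q⁻¹` of near-identity motions realises the commutator of operators:
`P Q - Q P = [P - 1, Q - 1]`. -/
theorem IsRealized.commutator {d : E → E → ℝ≥0∞} (htri : ∀ p q r, d p r ≤ d p q + d q r)
    {Ω : Set E} {k l : ℕ} (hk : 1 ≤ k) (hl : 1 ≤ l) {L L' : Module.End ℝ (smoothMaps E)}
    (h : IsRealized d Ω k L) (h' : IsRealized d Ω l L') :
    IsRealized d Ω (k + l) (L * L' - L' * L) := by
  obtain ⟨m, n, P, P', C, hC, hm, hn, hP, hd⟩ := h
  obtain ⟨m', n', Q, Q', C', hC', hm', hn', hQ, hd'⟩ := h'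
  refine ⟨_, _, P * Q * P' * Q', Q * P * Q' * P', C + C' + C + C', by positivity,
    ((hm.comp hm').comp hn).comp hn', ((hm'.comp hm).comp hn').comp hn,
    hP.commutator hk hl hQ, ?_⟩
  · have c1 (t) (p) (hp : p ∈ Ω) := (hd t p hp).1
    have c2 (t) (p) (hp : p ∈ Ω) := (hd t p hp).2
    have c1' (t) (p) (hp : p ∈ Ω) := (hd' t p hp).1
    have c2' (t) (p) (hp : p ∈ Ω) := (hd' t p hp).2
    intro t p hp
    refine ⟨motion_comp_cost htri (by positivity) hC' (motion_comp_cost htri (by positivity) hC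
      (motion_comp_cost htri hC hC' c1 c1') c2) c2' t p hp, ?_⟩
    have := motion_comp_cost htri (by positivity) hC (motion_comp_cost htri (by positivity) hC'
      (motion_comp_cost htri hC' hC c1' c1) c2') c2 t p hp
    rwa [show C' + C + C' + C = C + C' + C + C' by ring] at this

/-- Evaluating the expansion on the identity map: a realised vector field `V` gives, for small
`a`, a displacement `a V(p) + o(a)` at cost `O(|a| ^ (1 / k))`. Negative `a` use the inverse
motions. -/
theorem IsRealized.exists_displacement {d : E → E → ℝ≥0∞} {Ω : Set E} {k : ℕ} (hk : 1 ≤ k)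
    {V : E → E} {hV : ContDiff ℝ ∞ V} (h : IsRealized d Ω k (lieDerivative V hV)) :
    ∃ C : ℝ, 0 ≤ C ∧ ∀ a : ℝ, |a| ≤ 1 → ∀ p ∈ Ω, ∃ q ∈ Ω,
      d p q ≤ ENNReal.ofReal (C * |a| ^ (k : ℝ)⁻¹) ∧
      ‖q - p - a • V p‖ ≤ C * |a| ^ (k : ℝ)⁻¹ * |a| := by
  obtain ⟨m, n, A, B, C, hC, hm, hn, hAB, hd⟩ := h
  let idE : smoothMaps E := ⟨id, (contDiff_id : ContDiff ℝ ∞ (id : E → E))⟩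
  have hid (p : E) : (lieDerivative V hV idE : E → E) p = V p := by
    simp [lieDerivative_apply, idE]
  -- the terms of order at most `k` in a near-identity expansion
  have hpart {L : Module.End ℝ (smoothMaps E)}
      {P P' : PowerSeries (Module.End ℝ (smoothMaps E))} (hP : IsNearIdentity k L P P')
      (t : ℝ) (p : E) : ∑ j ∈ Finset.range (k + 1), t ^ j • (PowerSeries.coeff j P idE : E → E) p =
      p + t ^ k • (L idE : E → E) p := by
    obtain ⟨k, rfl⟩ := Nat.exists_eq_add_of_le' hk
    rw [Finset.sum_range_succ, Finset.sum_range_succ', Finset.sum_eq_zero fun j hj ↦ ?_,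
      hP.coeff_eq hk, hP.coeff_zero_eq hk]
    · simp [idE]
    · rw [hP.coeff_eq_zero j.succ_pos (by have := Finset.mem_range.1 hj; omega)]
      simp
  obtain ⟨C₁, hC₁⟩ := hm idE k
  obtain ⟨C₂, hC₂⟩ := hn idE k
  refine ⟨C + |C₁| + |C₂|, by positivity, fun a ha p hp ↦ ?_⟩
  set t : ℝ := |a| ^ (k : ℝ)⁻¹ with ht
  have ht0 : 0 ≤ t := Real.rpow_nonneg (abs_nonneg a) _
  have ht1 : |t| ≤ 1 := by
    rw [abs_of_nonneg ht0]
    exact Real.rpow_le_one (abs_nonneg a) ha (by positivity)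
  have htk : t ^ k = |a| := Real.rpow_inv_natCast_pow (abs_nonneg a) (by omega)
  have e1 := hC₁ t ht1 p
  have e2 := hC₂ t ht1 p
  rw [hpart hAB, hid, htk] at e1
  rw [hpart (hAB.symm hk), htk] at e2
  rw [abs_of_nonneg ht0, pow_succ, htk] at e1 e2
  simp only [LinearMap.neg_apply, Submodule.coe_neg, Pi.neg_apply, hid] at e2
  have hcost : ENNReal.ofReal (C * |t|) ≤ ENNReal.ofReal ((C + |C₁| + |C₂|) * t) := by
    rw [abs_of_nonneg ht0]
    gcongr
    linarith [abs_nonneg C₁, abs_nonneg C₂]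
  rcases le_total 0 a with h0 | h0
  · refine ⟨m t p, (hd t p hp).1.1, (hd t p hp).1.2.trans hcost, ?_⟩
    rw [abs_of_nonneg h0] at e1 ⊢
    calc _ = ‖m t p - (p + a • V p)‖ := by rw [sub_sub]
      _ ≤ C₁ * (a * t) := e1
      _ = C₁ * (t * a) := by ring
      _ ≤ (C + |C₁| + |C₂|) * (t * a) := by
        gcongr
        linarith [le_abs_self C₁, abs_nonneg C₂]
      _ = _ := by ring
  · refine ⟨n t p, (hd t p hp).2.1, (hd t p hp).2.2.trans hcost, ?_⟩
    rw [abs_of_nonpos h0] at e2 ⊢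
    calc _ = ‖n t p - (p + -a • -V p)‖ := by rw [sub_sub, neg_smul_neg]
      _ ≤ C₂ * (-a * t) := e2
      _ = C₂ * (t * -a) := by ring
      _ ≤ (C + |C₁| + |C₂|) * (t * -a) := by
        have : 0 ≤ -a := by linarith
        gcongr
        linarith [le_abs_self C₂, abs_nonneg C₁]
      _ = _ := by ring

end Realization

/-! ### Attainable displacements and Newton iteration -/

section Attainability

variable {E F G : Type*} [NormedAddCommGroup E] [NormedSpace ℝ E] [NormedAddCommGroup F]
  [NormedSpace ℝ F] [NormedAddCommGroup G] [NormedSpace ℝ G]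

/-- Displacements in the range of `T : F → E` are attainable near `z₀`: from any point `p` near `z₀`
and for any small `a`, one can move by `T a + o(a)` at a cost that is Hölder in `a`. -/
def IsAttainable (d : E → E → ℝ≥0∞) (Ω : Set E) (z₀ : E) (T : F →L[ℝ] E) : Prop :=
  ∀ ε > 0, ∃ η > 0, ∃ C ≥ (0 : ℝ), ∃ α > (0 : ℝ), ∀ p ∈ Ω, ‖p - z₀‖ ≤ η → ∀ a : F, ‖a‖ ≤ η →
    ∃ q ∈ Ω, d p q ≤ ENNReal.ofReal (C * ‖a‖ ^ α) ∧ ‖q - p - T a‖ ≤ ε * ‖a‖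

variable {d : E → E → ℝ≥0∞} {Ω : Set E} {z₀ : E}

theorem isAttainable_zero (hd : ∀ p, d p p = 0) :
    IsAttainable d Ω z₀ (0 : F →L[ℝ] E) := fun ε hε ↦
  ⟨1, one_pos, 0, le_rfl, 1, one_pos, fun p hp _ a _ ↦ ⟨p, hp, by simp [hd], by
    simpa using mul_nonneg hε.le (norm_nonneg a)⟩⟩

theorem IsAttainable.add (htri : ∀ p q r, d p r ≤ d p q + d q r) {T S : F →L[ℝ] E}
    (hT : IsAttainable d Ω z₀ T) (hS : IsAttainable d Ω z₀ S) : IsAttainable d Ω z₀ (T + S) := by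
  intro ε hε
  obtain ⟨η₁, hη₁, C₁, hC₁, α₁, hα₁, h₁⟩ := hT (ε / 2) (half_pos hε)
  obtain ⟨η₂, hη₂, C₂, hC₂, α₂, hα₂, h₂⟩ := hS (ε / 2) (half_pos hε)
  set K : ℝ := 1 + ‖T‖ + ε / 2 with hK
  have hK1 : 1 ≤ K := by rw [hK]; linarith [norm_nonneg T]
  have hK0 : 0 < K := by linarith
  refine ⟨min (min 1 η₁) (η₂ / K), by positivity, C₁ + C₂, by positivity, min α₁ α₂,
    lt_min hα₁ hα₂, fun p hp hpz a ha ↦ ?_⟩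
  set η := min (min 1 η₁) (η₂ / K) with hη
  have hη1 : η ≤ 1 := (min_le_left _ _).trans (min_le_left _ _)
  have hηη₁ : η ≤ η₁ := (min_le_left _ _).trans (min_le_right _ _)
  have hηη₂ : η * K ≤ η₂ := (le_div_iff₀ hK0).1 (min_le_right _ _)
  have hη₂' : η ≤ η₂ := by
    have : 0 ≤ η := (norm_nonneg _).trans ha
    nlinarith
  obtain ⟨q, hq, hdq, hnq⟩ := h₁ p hp (hpz.trans hηη₁) a (ha.trans hηη₁)
  have hqz : ‖q - z₀‖ ≤ η₂ := by
    calc ‖q - z₀‖ = ‖(p - z₀) + (q - p - T a) + T a‖ := by congr 1; abel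
      _ ≤ ‖p - z₀‖ + ‖q - p - T a‖ + ‖T a‖ := norm_add₃_le
      _ ≤ η + ε / 2 * ‖a‖ + ‖T‖ * ‖a‖ := by gcongr; exact T.le_opNorm a
      _ ≤ η + ε / 2 * η + ‖T‖ * η := by gcongr
      _ = η * K := by rw [hK]; ring
      _ ≤ η₂ := hηη₂
  obtain ⟨r, hr, hdr, hnr⟩ := h₂ q hq hqz a (ha.trans hη₂')
  refine ⟨r, hr, ?_, ?_⟩
  · have hpow {α : ℝ} (hα : min α₁ α₂ ≤ α) : ‖a‖ ^ α ≤ ‖a‖ ^ min α₁ α₂ :=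
      Real.rpow_le_rpow_of_exponent_ge_of_imp (norm_nonneg a) (ha.trans hη1) hα
        fun _ h ↦ absurd h ((lt_min hα₁ hα₂).trans_le hα).ne'
    refine (htri p q r).trans ((add_le_add hdq hdr).trans ?_)
    rw [← ENNReal.ofReal_add (by positivity) (by positivity), add_mul]
    exact ENNReal.ofReal_le_ofReal (add_le_add
      (mul_le_mul_of_nonneg_left (hpow (min_le_left _ _)) hC₁)
      (mul_le_mul_of_nonneg_left (hpow (min_le_right _ _)) hC₂))
  · calc ‖r - p - (T + S) a‖ = ‖(q - p - T a) + (r - q - S a)‖ := by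
          congr 1; simp only [add_apply]; abel
      _ ≤ ε / 2 * ‖a‖ + ε / 2 * ‖a‖ := (norm_add_le _ _).trans (add_le_add hnq hnr)
      _ = ε * ‖a‖ := by ring

theorem IsAttainable.comp {T : F →L[ℝ] E} (hT : IsAttainable d Ω z₀ T) (S : G →L[ℝ] F) :
    IsAttainable d Ω z₀ (T.comp S) := by
  intro ε hε
  have hK : 0 < ‖S‖ + 1 := by positivity
  obtain ⟨η, hη, C, hC, α, hα, h⟩ := hT (ε / (‖S‖ + 1)) (by positivity)
  refine ⟨η / (‖S‖ + 1), by positivity, C * ‖S‖ ^ α, by positivity, α, hα, fun p hp hpz a ha ↦ ?_⟩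
  have hSa : ‖S a‖ ≤ η := by
    have h1 := S.le_opNorm a
    have h2 := (le_div_iff₀ hK).1 ha
    nlinarith [norm_nonneg a, norm_nonneg S]
  have hp' : ‖p - z₀‖ ≤ η := hpz.trans (div_le_self hη.le (by linarith [norm_nonneg S]))
  obtain ⟨q, hq, hdq, hnq⟩ := h p hp hp' (S a) hSa
  refine ⟨q, hq, hdq.trans (ENNReal.ofReal_le_ofReal ?_), hnq.trans ?_⟩
  · rw [mul_assoc, ← Real.mul_rpow (norm_nonneg _) (norm_nonneg _)]
    gcongr
    exact S.le_opNorm a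
  · rw [div_mul_eq_mul_div, div_le_iff₀ hK, mul_assoc]
    gcongr
    have h1 := S.le_opNorm a
    nlinarith [norm_nonneg a, norm_nonneg S]

theorem IsAttainable.sum (hd : ∀ p, d p p = 0) (htri : ∀ p q r, d p r ≤ d p q + d q r)
    {ι : Type*} (s : Finset ι) {T : ι → F →L[ℝ] E} (hT : ∀ i ∈ s, IsAttainable d Ω z₀ (T i)) :
    IsAttainable d Ω z₀ (∑ i ∈ s, T i) := by
  classical
  induction s using Finset.induction_on with
  | empty => simpa using isAttainable_zero hd
  | insert i s hi ih =>
    rw [Finset.sum_insert hi]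
    exact (hT i (Finset.mem_insert_self i s)).add htri
      (ih fun j hj ↦ hT j (Finset.mem_insert_of_mem hj))

/-- The direction of a realised vector field is attainable. -/
theorem IsRealized.isAttainable {k : ℕ} (hk : 1 ≤ k) {V : E → E} {hV : ContDiff ℝ ∞ V}
    (h : IsRealized d Ω k (lieDerivative V hV)) :
    IsAttainable d Ω z₀ (ContinuousLinearMap.toSpanSingleton ℝ (V z₀)) := by
  intro ε hε
  obtain ⟨C, hC, hmove⟩ := h.exists_displacement hk
  have hα : 0 < (k : ℝ)⁻¹ := by positivity
  obtain ⟨η₁, hη₁, hη₁'⟩ := Metric.continuousAt_iff.1 hV.continuous.continuousAt (ε / 2)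
    (half_pos hε)
  have hsmall : Tendsto (fun t : ℝ ↦ C * t ^ (k : ℝ)⁻¹) (𝓝 0) (𝓝 (C * 0 ^ (k : ℝ)⁻¹)) :=
    ((Real.continuousAt_rpow_const 0 _ (Or.inr hα.le)).tendsto).const_mul C
  rw [Real.zero_rpow hα.ne', mul_zero] at hsmall
  obtain ⟨η₂, hη₂, hη₂'⟩ := Metric.eventually_nhds_iff.1
    (hsmall.eventually (gt_mem_nhds (half_pos hε)))
  refine ⟨min 1 (min (η₁ / 2) (η₂ / 2)), by positivity, C, hC, (k : ℝ)⁻¹, hα,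
    fun p hp hpz a ha ↦ ?_⟩
  obtain ⟨q, hq, hdq, hnq⟩ := hmove a (ha.trans (min_le_left _ _)) p hp
  refine ⟨q, hq, hdq, ?_⟩
  have h1 : ‖V p - V z₀‖ ≤ ε / 2 := by
    rw [← dist_eq_norm]
    refine (hη₁' ?_).le
    rw [dist_eq_norm]
    exact (hpz.trans ((min_le_right _ _).trans (min_le_left _ _))).trans_lt (half_lt_self hη₁)
  have h2 : C * |a| ^ (k : ℝ)⁻¹ ≤ ε / 2 := by
    refine (hη₂' ?_).le
    rw [Real.dist_eq, sub_zero, abs_abs]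
    exact (ha.trans ((min_le_right _ _).trans (min_le_right _ _))).trans_lt (half_lt_self hη₂)
  calc ‖q - p - ContinuousLinearMap.toSpanSingleton ℝ (V z₀) a‖
      = ‖(q - p - a • V p) + a • (V p - V z₀)‖ := by
        congr 1
        rw [ContinuousLinearMap.toSpanSingleton_apply, smul_sub]
        abel
    _ ≤ C * |a| ^ (k : ℝ)⁻¹ * |a| + |a| * ‖V p - V z₀‖ := by
        refine (norm_add_le _ _).trans (add_le_add hnq ?_)
        rw [norm_smul, Real.norm_eq_abs]
    _ ≤ ε / 2 * |a| + |a| * (ε / 2) := by gcongr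
    _ = ε * ‖a‖ := by rw [Real.norm_eq_abs]; ring

/-- If the attainable directions span `E`, all displacements are attainable. -/
theorem isAttainable_id_of_span_eq_top [FiniteDimensional ℝ E] (hd : ∀ p, d p p = 0)
    (htri : ∀ p q r, d p r ≤ d p q + d q r)
    (hspan : Submodule.span ℝ
      {v : E | IsAttainable d Ω z₀ (ContinuousLinearMap.toSpanSingleton ℝ v)} = ⊤) :
    IsAttainable d Ω z₀ (ContinuousLinearMap.id ℝ E) := by
  have hall (v : E) : IsAttainable d Ω z₀ (ContinuousLinearMap.toSpanSingleton ℝ v) := by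
    have hv : v ∈ Submodule.span ℝ
        {v : E | IsAttainable d Ω z₀ (ContinuousLinearMap.toSpanSingleton ℝ v)} :=
      hspan ▸ Submodule.mem_top
    induction hv using Submodule.span_induction with
    | mem v hv => exact hv
    | zero => simpa using isAttainable_zero hd
    | add v w _ _ hv hw =>
      rw [ContinuousLinearMap.toSpanSingleton_add]
      exact hv.add htri hw
    | smul c v _ hv =>
      have h := hv.comp (c • ContinuousLinearMap.id ℝ ℝ)
      convert h using 1
      ext
      simp
  let b := Module.finBasis ℝ E
  have h := IsAttainable.sum (Ω := Ω) (z₀ := z₀) hd htri Finset.univ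
    (T := fun i ↦ (ContinuousLinearMap.toSpanSingleton ℝ (b i)).comp
      (LinearMap.toContinuousLinearMap (b.coord i))) fun i _ ↦ (hall (b i)).comp _
  convert h using 1
  ext v
  simp [b.sum_repr]

/-- Newton-type iteration: if all displacements are attainable near `z₀`, correcting the remaining
displacement again and again reaches any nearby point in the limit, and the costs, being geometric,
stay summable. -/
theorem IsAttainable.exists_seq_tendsto (hd : ∀ p, d p p = 0)
    (htri : ∀ p q r, d p r ≤ d p q + d q r) (hz₀ : z₀ ∈ Ω)
    (h : IsAttainable d Ω z₀ (ContinuousLinearMap.id ℝ E)) :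
    ∀ᶠ y in 𝓝 z₀, ∃ L : ℝ, ∃ u : ℕ → E, Tendsto u atTop (𝓝 y) ∧
      ∀ n, d z₀ (u n) ≤ ENNReal.ofReal L := by
  obtain ⟨η, hη, C, hC, α, hα, hstep⟩ := h (1 / 2) (by norm_num)
  filter_upwards [Metric.closedBall_mem_nhds z₀ (half_pos hη)] with y hy
  set ρ := η / 2 with hρ
  have hyz : ‖y - z₀‖ ≤ ρ := by rwa [← dist_eq_norm]
  let S : Type _ := {p : E // p ∈ Ω ∧ ‖y - p‖ ≤ ρ}
  have hnext (s : S) : ∃ s' : S, d s.1 s'.1 ≤ ENNReal.ofReal (C * ‖y - s.1‖ ^ α) ∧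
      ‖y - s'.1‖ ≤ 1 / 2 * ‖y - s.1‖ := by
    obtain ⟨p, hp, hyp⟩ := s
    have hpz : ‖p - z₀‖ ≤ η := by
      calc ‖p - z₀‖ = ‖(y - z₀) - (y - p)‖ := by congr 1; abel
        _ ≤ ρ + ρ := (norm_sub_le _ _).trans (add_le_add hyz hyp)
        _ = η := by rw [hρ]; ring
    obtain ⟨q, hq, hdq, hnq⟩ := hstep p hp hpz (y - p) (hyp.trans (by linarith))
    have hyq : ‖y - q‖ ≤ 1 / 2 * ‖y - p‖ := by
      calc ‖y - q‖ = ‖q - p - ContinuousLinearMap.id ℝ E (y - p)‖ := by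
            rw [norm_sub_rev, ContinuousLinearMap.id_apply]; congr 1; abel
        _ ≤ 1 / 2 * ‖y - p‖ := hnq
    exact ⟨⟨q, hq, by linarith [norm_nonneg (y - p)]⟩, hdq, hyq⟩
  choose next hcost hhalf using hnext
  let s₀ : S := ⟨z₀, hz₀, hyz⟩
  let u : ℕ → S := fun n ↦ next^[n] s₀
  have hu (n : ℕ) : u (n + 1) = next (u n) := Function.iterate_succ_apply' next n s₀
  have hdist (n : ℕ) : ‖y - (u n).1‖ ≤ (1 / 2) ^ n * ρ := by
    induction n with
    | zero => simpa [u] using hyz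
    | succ n ih =>
      rw [hu, pow_succ]
      linarith [hhalf (u n)]
  set r : ℝ := (1 / 2 : ℝ) ^ α with hr
  have hr0 : 0 ≤ r := by positivity
  have hr1 : r < 1 := Real.rpow_lt_one (by norm_num) (by norm_num) hα
  have hsum (n : ℕ) : d z₀ (u n).1 ≤
      ENNReal.ofReal (C * ρ ^ α * ∑ j ∈ Finset.range n, r ^ j) := by
    induction n with
    | zero => simp [u, s₀, hd]
    | succ n ih =>
      rw [Finset.sum_range_succ, mul_add, ENNReal.ofReal_add (by positivity) (by positivity), hu]
      refine (htri _ (u n).1 _).trans (add_le_add ih ((hcost (u n)).trans ?_))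
      refine ENNReal.ofReal_le_ofReal ?_
      rw [mul_assoc]
      refine mul_le_mul_of_nonneg_left ?_ hC
      calc ‖y - (u n).1‖ ^ α ≤ ((1 / 2) ^ n * ρ) ^ α := by gcongr; exact hdist n
        _ = ρ ^ α * r ^ n := by
          rw [Real.mul_rpow (by positivity) (by positivity), hr, ← Real.rpow_natCast,
            ← Real.rpow_natCast, ← Real.rpow_mul (by norm_num), ← Real.rpow_mul (by norm_num),
            mul_comm (n : ℝ), mul_comm]
  refine ⟨C * ρ ^ α * (1 - r)⁻¹, fun n ↦ (u n).1, ?_, fun n ↦ (hsum n).trans ?_⟩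
  · rw [tendsto_iff_norm_sub_tendsto_zero]
    refine squeeze_zero (fun _ ↦ norm_nonneg _)
      (fun n ↦ (norm_sub_rev _ _).trans_le (hdist n)) ?_
    simpa using (tendsto_pow_atTop_nhds_zero_of_lt_one (r := (1 / 2 : ℝ)) (by norm_num)
      (by norm_num)).mul_const ρ
  · refine ENNReal.ofReal_le_ofReal (mul_le_mul_of_nonneg_left ?_ (by positivity))
    rw [← tsum_geometric_of_lt_one hr0 hr1]
    exact (summable_geometric_of_lt_one hr0 hr1).sum_le_tsum _ fun _ _ ↦ by positivity

end Attainability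

/-! ### Transfer to the manifold -/

section ChartTransfer

variable {E : Type*} [NormedAddCommGroup E] [NormedSpace ℝ E] [FiniteDimensional ℝ E]
  {M : Type*} [TopologicalSpace M] [ChartedSpace E M] [IsManifold 𝓘(ℝ, E) ∞ M]

omit [FiniteDimensional ℝ E] in
theorem contMDiffAt_extChartAt_symm {x₀ : M} {z : E} (hz : z ∈ (extChartAt 𝓘(ℝ, E) x₀).target) :
    ContMDiffAt 𝓘(ℝ, E) 𝓘(ℝ, E) ∞ (extChartAt 𝓘(ℝ, E) x₀).symm z :=
  (contMDiffOn_extChartAt_symm x₀).contMDiffAt ((isOpen_extChartAt_target x₀).mem_nhds hz)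

omit [FiniteDimensional ℝ E] in
theorem isInvertible_mfderiv_extChartAt_symm {x₀ : M} {z : E}
    (hz : z ∈ (extChartAt 𝓘(ℝ, E) x₀).target) :
    (mfderiv 𝓘(ℝ, E) 𝓘(ℝ, E) (extChartAt 𝓘(ℝ, E) x₀).symm z).IsInvertible := by
  have h := isInvertible_mfderivWithin_extChartAt_symm (I := 𝓘(ℝ, E)) hz
  rwa [modelWithCornersSelf_coe, range_id, mfderivWithin_univ] at h

/-- The expression of the vector field `X` in the chart at `x₀`. -/
def chartVectorField (x₀ : M) (X : ∀ x : M, TangentSpace 𝓘(ℝ, E) x) : E → E :=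
  VectorField.mpullback 𝓘(ℝ, E) 𝓘(ℝ, E) (extChartAt 𝓘(ℝ, E) x₀).symm X

theorem contDiffAt_chartVectorField {x₀ : M} {X : ∀ x : M, TangentSpace 𝓘(ℝ, E) x}
    (hX : ContMDiff 𝓘(ℝ, E) 𝓘(ℝ, E).tangent ∞
      (fun x ↦ (⟨x, X x⟩ : TangentBundle 𝓘(ℝ, E) M)))
    {z : E} (hz : z ∈ (extChartAt 𝓘(ℝ, E) x₀).target) :
    ContDiffAt ℝ ∞ (chartVectorField x₀ X) z :=
  contMDiffAt_vectorSpace_iff_contDiffAt.1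
    ((hX _).mpullback_vectorField_preimage (contMDiffAt_extChartAt_symm hz)
      (isInvertible_mfderiv_extChartAt_symm hz) (by simp))

omit [FiniteDimensional ℝ E] in
theorem mfderiv_symm_chartVectorField {x₀ : M} (X : ∀ x : M, TangentSpace 𝓘(ℝ, E) x)
    {z : E} (hz : z ∈ (extChartAt 𝓘(ℝ, E) x₀).target) :
    mfderiv 𝓘(ℝ, E) 𝓘(ℝ, E) (extChartAt 𝓘(ℝ, E) x₀).symm z (chartVectorField (E := E) x₀ X z) =
      X ((extChartAt 𝓘(ℝ, E) x₀).symm z) := by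
  obtain ⟨e, he⟩ := isInvertible_mfderiv_extChartAt_symm hz
  change (mfderiv 𝓘(ℝ, E) 𝓘(ℝ, E) (extChartAt 𝓘(ℝ, E) x₀).symm z)
    ((mfderiv 𝓘(ℝ, E) 𝓘(ℝ, E) (extChartAt 𝓘(ℝ, E) x₀).symm z).inverse _) = _
  rw [← he, ContinuousLinearMap.inverse_equiv]
  exact e.apply_symm_apply _

omit [FiniteDimensional ℝ E] in
theorem mlieBracket_eq_lieBracket (V W : ∀ z : E, TangentSpace 𝓘(ℝ, E) z) :
    VectorField.mlieBracket 𝓘(ℝ, E) V W = VectorField.lieBracket ℝ V W := by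
  rw [← VectorField.mlieBracketWithin_univ]
  exact VectorField.mlieBracketWithin_eq_lieBracketWithin.trans VectorField.lieBracketWithin_univ

theorem chartVectorField_mlieBracket {x₀ : M} {X Y : ∀ x : M, TangentSpace 𝓘(ℝ, E) x}
    (hX : ContMDiff 𝓘(ℝ, E) 𝓘(ℝ, E).tangent ∞
      (fun x ↦ (⟨x, X x⟩ : TangentBundle 𝓘(ℝ, E) M)))
    (hY : ContMDiff 𝓘(ℝ, E) 𝓘(ℝ, E).tangent ∞
      (fun x ↦ (⟨x, Y x⟩ : TangentBundle 𝓘(ℝ, E) M)))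
    {z : E} (hz : z ∈ (extChartAt 𝓘(ℝ, E) x₀).target) :
    chartVectorField x₀ (VectorField.mlieBracket 𝓘(ℝ, E) X Y) z =
      VectorField.lieBracket ℝ (chartVectorField x₀ X) (chartVectorField x₀ Y) z := by
  have : IsManifold 𝓘(ℝ, E) (minSmoothness ℝ 2) M := by
    rw [minSmoothness_of_isRCLikeNormedField]
    infer_instance
  have h := VectorField.mpullback_mlieBracket (I := 𝓘(ℝ, E)) (n := ∞)
    ((hX ((extChartAt 𝓘(ℝ, E) x₀).symm z)).mdifferentiableAt (by simp))
    ((hY ((extChartAt 𝓘(ℝ, E) x₀).symm z)).mdifferentiableAt (by simp))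
    (contMDiffAt_extChartAt_symm hz)
    (by rw [minSmoothness_of_isRCLikeNormedField]; exact WithTop.coe_le_coe.2 le_top)
  exact h.trans (congrFun (mlieBracket_eq_lieBracket _ _) z)

theorem contMDiff_mlieBracket {X Y : ∀ x : M, TangentSpace 𝓘(ℝ, E) x}
    (hX : ContMDiff 𝓘(ℝ, E) 𝓘(ℝ, E).tangent ∞
      (fun x ↦ (⟨x, X x⟩ : TangentBundle 𝓘(ℝ, E) M)))
    (hY : ContMDiff 𝓘(ℝ, E) 𝓘(ℝ, E).tangent ∞
      (fun x ↦ (⟨x, Y x⟩ : TangentBundle 𝓘(ℝ, E) M))) :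
    ContMDiff 𝓘(ℝ, E) 𝓘(ℝ, E).tangent ∞
      (fun x ↦ (⟨x, VectorField.mlieBracket 𝓘(ℝ, E) X Y x⟩ : TangentBundle 𝓘(ℝ, E) M)) := by
  have : IsManifold 𝓘(ℝ, E) ((⊤ : ℕ∞) + 1) M := ‹IsManifold 𝓘(ℝ, E) ∞ M›
  have : IsManifold 𝓘(ℝ, E) (minSmoothness ℝ 2) M := by
    rw [minSmoothness_of_isRCLikeNormedField]
    infer_instance
  exact ContDiff.mlieBracket_vectorField (m := ⊤) (n := ⊤) hX hY
    (by rw [minSmoothness_of_isRCLikeNormedField]; exact le_rfl)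

variable [RiemannianBundle (fun x : M ↦ TangentSpace 𝓘(ℝ, E) x)]
  [IsContMDiffRiemannianBundle 𝓘(ℝ, E) ∞ E (fun x : M ↦ TangentSpace 𝓘(ℝ, E) x)]
  (D : ∀ x : M, Submodule ℝ (TangentSpace 𝓘(ℝ, E) x))

/-- `horizontalEDist` read in the chart at `x₀`; the values off the target of the chart are
irrelevant. -/
def chartEDist (x₀ : M) (p q : E) : ℝ≥0∞ :=
  horizontalEDist D ((extChartAt 𝓘(ℝ, E) x₀).symm p) ((extChartAt 𝓘(ℝ, E) x₀).symm q)

omit [FiniteDimensional ℝ E] in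
theorem continuous_norm_section {X : ∀ x : M, TangentSpace 𝓘(ℝ, E) x}
    (hX : ContMDiff 𝓘(ℝ, E) 𝓘(ℝ, E).tangent ∞
      (fun x ↦ (⟨x, X x⟩ : TangentBundle 𝓘(ℝ, E) M))) : Continuous fun x ↦ ‖X x‖ := by
  have h : ContMDiff 𝓘(ℝ, E) 𝓘(ℝ, ℝ) ∞ fun x ↦ inner ℝ (X x) (X x) := by
    refine ContMDiff.inner_bundle (IB := 𝓘(ℝ, E)) (IM := 𝓘(ℝ, E)) (F := E)
      (E := fun x : M ↦ TangentSpace 𝓘(ℝ, E) x) (n := ∞) (b := id) (v := X) (w := X) ?_ ?_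
    · exact hX
    · exact hX
  replace h := h.continuous
  simpa [real_inner_self_eq_norm_sq, Real.sqrt_sq (norm_nonneg _)] using h.sqrt

omit [IsManifold 𝓘(ℝ, E) ∞ M]
  [IsContMDiffRiemannianBundle 𝓘(ℝ, E) ∞ E (fun x : M ↦ TangentSpace 𝓘(ℝ, E) x)] in
theorem chartEDist_self (x₀ : M) (p : E) : chartEDist D x₀ p p = 0 :=
  horizontalEDist_self D _

omit [IsManifold 𝓘(ℝ, E) ∞ M]
  [IsContMDiffRiemannianBundle 𝓘(ℝ, E) ∞ E (fun x : M ↦ TangentSpace 𝓘(ℝ, E) x)] in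
theorem chartEDist_triangle (x₀ : M) (p q r : E) :
    chartEDist D x₀ p r ≤ chartEDist D x₀ p q + chartEDist D x₀ q r :=
  horizontalEDist_triangle D _ _ _

/-- A smooth section of `D`, cut off in a chart, is realised at order `1` by its flow: in `M` the
flow lines are horizontal curves of bounded speed, and they stay in the chart. -/
theorem exists_isRealized_of_section {X : ∀ x : M, TangentSpace 𝓘(ℝ, E) x}
    (hX : ContMDiff 𝓘(ℝ, E) 𝓘(ℝ, E).tangent ∞
      (fun x ↦ (⟨x, X x⟩ : TangentBundle 𝓘(ℝ, E) M))) (hXD : ∀ x, X x ∈ D x) (x₀ : M) :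
    ∃ (V : E → E) (hV : ContDiff ℝ ∞ V),
      IsRealized (chartEDist D x₀) (extChartAt 𝓘(ℝ, E) x₀).target 1 (lieDerivative V hV) ∧
      V =ᶠ[𝓝 (extChartAt 𝓘(ℝ, E) x₀ x₀)] chartVectorField x₀ X := by
  set φ := extChartAt 𝓘(ℝ, E) x₀ with hφ
  have hopen : IsOpen φ.target := isOpen_extChartAt_target x₀
  obtain ⟨r, hr, hball⟩ := Metric.nhds_basis_closedBall.mem_iff.1
    (hopen.mem_nhds (mem_extChartAt_target (I := 𝓘(ℝ, E)) x₀))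
  let χ : ContDiffBump (φ x₀) := ⟨r / 2, r, half_pos hr, half_lt_self hr⟩
  have hχ : tsupport χ ⊆ φ.target := by rw [χ.tsupport_eq]; exact hball
  let V : E → E := fun z ↦ χ z • chartVectorField x₀ X z
  have hVs : tsupport V ⊆ tsupport χ := closure_mono fun z hz ↦ by
    contrapose! hz
    simp only [Function.mem_support, not_not] at hz
    simp [V, hz]
  have hVc : HasCompactSupport V := χ.hasCompactSupport.mono' (subset_tsupport _ |>.trans hVs)
  have hV : ContDiff ℝ ∞ V := by
    refine contDiff_iff_contDiffAt.2 fun z ↦ ?_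
    by_cases hz : z ∈ φ.target
    · exact χ.contDiff.contDiffAt.smul (contDiffAt_chartVectorField hX hz)
    · have hz' : z ∉ tsupport V := fun h ↦ hz (hχ (hVs h))
      exact contDiffAt_const.congr_of_eventuallyEq (notMem_tsupport_iff_eventuallyEq.1 hz')
  have hnorm : ContinuousOn (fun z ↦ ‖X (φ.symm z)‖) (Metric.closedBall (φ x₀) r) :=
    (continuous_norm_section hX).comp_continuousOn
      ((continuousOn_extChartAt_symm x₀).mono hball)
  obtain ⟨B, hB⟩ := (isCompact_closedBall (φ x₀) r).exists_bound_of_continuousOn hnorm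
  have hB0 : 0 ≤ B := (norm_nonneg _).trans (hB _ (Metric.mem_closedBall_self hr.le))
  have hspeed {z : E} (hz : z ∈ φ.target) :
      mfderiv 𝓘(ℝ, E) 𝓘(ℝ, E) φ.symm z (V z) = χ z • X (φ.symm z) := by
    rw [← mfderiv_symm_chartVectorField X hz]
    exact (mfderiv 𝓘(ℝ, E) 𝓘(ℝ, E) φ.symm z).map_smul (χ z) (chartVectorField (E := E) x₀ X z)
  have hbound (z : E) : ‖χ z • X (φ.symm z)‖ ≤ B := by
    by_cases hz : z ∈ Metric.closedBall (φ x₀) r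
    · have h := hB z hz
      rw [norm_norm] at h
      rw [norm_smul, Real.norm_of_nonneg χ.nonneg]
      exact (mul_le_of_le_one_left (norm_nonneg _) χ.le_one).trans h
    · have : χ z = 0 := image_eq_zero_of_notMem_tsupport (by rwa [χ.tsupport_eq])
      simpa [this] using hB0
  obtain ⟨K, hK⟩ := hV.lipschitzWith_of_hasCompactSupport hVc (by simp)
  refine ⟨V, hV, isRealized_of_flow hV hVc hB0 fun c hc hc0 t ↦ ?_, ?_⟩
  · have hmem := integralCurve_mem_of_tsupport_subset hK (hVs.trans hχ) hc hc0
    refine ⟨hmem t, ?_⟩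
    have hc1 : ContDiff ℝ 1 c := by
      rw [contDiff_one_iff_deriv]
      refine ⟨fun s ↦ (hc s).differentiableAt, ?_⟩
      rw [show deriv c = fun s ↦ V (c s) from funext fun s ↦ (hc s).deriv]
      exact hV.continuous.comp (continuous_iff_continuousAt.2 fun s ↦ (hc s).continuousAt)
    have hγ : ContMDiff 𝓘(ℝ, ℝ) 𝓘(ℝ, E) 1 (φ.symm ∘ c) :=
      (contMDiffOn_extChartAt_symm x₀).comp_contMDiff (contMDiff_iff_contDiff.2 hc1) hmem
    have hderiv (s : ℝ) :
        mfderiv 𝓘(ℝ, ℝ) 𝓘(ℝ, E) (φ.symm ∘ c) s 1 = χ (c s) • X (φ.symm (c s)) := by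
      rw [← hspeed (hmem s), mfderiv_comp s
        ((contMDiffAt_extChartAt_symm (hmem s)).mdifferentiableAt (by simp))
        ((hc s).differentiableAt.mdifferentiableAt)]
      have : mfderiv 𝓘(ℝ, ℝ) 𝓘(ℝ, E) c s 1 = V (c s) := by
        rw [mfderiv_eq_fderiv]
        change fderiv ℝ c s (1 : ℝ) = _
        rw [(hc s).hasFDerivAt.fderiv]
        exact one_smul ℝ _
      exact congrArg (mfderiv 𝓘(ℝ, E) 𝓘(ℝ, E) φ.symm (c s)) this
    have h := horizontalEDist_le_of_horizontal_abs D hγ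
      (fun s ↦ by rw [hderiv]; exact (D _).smul_mem _ (hXD _)) (C := B)
      (fun s ↦ by rw [hderiv]; exact hbound (c s)) 0 t
    rw [sub_zero] at h
    exact h
  · filter_upwards [χ.eventuallyEq_one] with z hz
    simp [V, hz]

/-- Every iterated bracket of sections of `D` is realised, at some order, near a given point. The
vector field `V` on `E` agrees with the bracket only near that point, because of the cut-offs. -/
theorem IsIteratedBracket.exists_isRealized {X : ∀ x : M, TangentSpace 𝓘(ℝ, E) x}
    (hX : IsIteratedBracket D X) (x₀ : M) :
    ContMDiff 𝓘(ℝ, E) 𝓘(ℝ, E).tangent ∞ (fun x ↦ (⟨x, X x⟩ : TangentBundle 𝓘(ℝ, E) M)) ∧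
    ∃ (k : ℕ) (V : E → E) (hV : ContDiff ℝ ∞ V), 1 ≤ k ∧
      IsRealized (chartEDist D x₀) (extChartAt 𝓘(ℝ, E) x₀).target k (lieDerivative V hV) ∧
      V =ᶠ[𝓝 (extChartAt 𝓘(ℝ, E) x₀ x₀)] chartVectorField x₀ X := by
  induction hX with
  | of_section X hX hXD =>
    obtain ⟨V, hV, h⟩ := exists_isRealized_of_section D hX hXD x₀
    exact ⟨hX, 1, V, hV, le_rfl, h⟩
  | bracket X Y _ _ ihX ihY =>
    obtain ⟨hX, k, V, hV, hk, hVr, hVX⟩ := ihX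
    obtain ⟨hY, l, W, hW, hl, hWr, hWY⟩ := ihY
    refine ⟨contMDiff_mlieBracket hX hY, k + l, VectorField.lieBracket ℝ V W,
      contDiff_lieBracket hV hW, by omega, ?_, ?_⟩
    · have h := IsRealized.commutator (chartEDist_triangle D x₀) hk hl hVr hWr
      rw [← lieDerivative_lieBracket hV hW] at h
      exact h
    · filter_upwards [hVX.eventuallyEq_nhds, hWY.eventuallyEq_nhds,
        extChartAt_target_mem_nhds (I := 𝓘(ℝ, E)) x₀] with z hVz hWz hz
      rw [chartVectorField_mlieBracket hX hY hz]
      exact hVz.lieBracket_vectorField_eq hWz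

/-- If `D` is bracket-generating, all displacements are attainable near every point. -/
theorem IsBracketGenerating.isAttainable_id {D} (hD : IsBracketGenerating D) (x₀ : M) :
    IsAttainable (chartEDist D x₀) (extChartAt 𝓘(ℝ, E) x₀).target (extChartAt 𝓘(ℝ, E) x₀ x₀)
      (ContinuousLinearMap.id ℝ E) := by
  set φ := extChartAt 𝓘(ℝ, E) x₀ with hφ
  have hz₀ : φ x₀ ∈ φ.target := mem_extChartAt_target x₀
  refine isAttainable_id_of_span_eq_top (chartEDist_self D x₀) (chartEDist_triangle D x₀) ?_
  let A : TangentSpace 𝓘(ℝ, E) (φ.symm (φ x₀)) →L[ℝ] E :=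
    (mfderiv 𝓘(ℝ, E) 𝓘(ℝ, E) φ.symm (φ x₀)).inverse
  have hA : Function.Surjective A := by
    obtain ⟨e, he⟩ := isInvertible_mfderiv_extChartAt_symm hz₀
    change Function.Surjective (mfderiv 𝓘(ℝ, E) 𝓘(ℝ, E) φ.symm (φ x₀)).inverse
    rw [← he, ContinuousLinearMap.inverse_equiv]
    exact e.symm.surjective
  rw [eq_top_iff, ← LinearMap.range_eq_top.2 hA, ← Submodule.map_top, ← hD (φ.symm (φ x₀)),
    Submodule.map_span]
  refine Submodule.span_mono ?_
  rintro _ ⟨_, ⟨X, hX, rfl⟩, rfl⟩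
  obtain ⟨-, k, V, hV, hk, hr, hVX⟩ := hX.exists_isRealized D x₀
  have h := hr.isAttainable (z₀ := φ x₀) hk
  rw [hVX.self_of_nhds] at h
  exact h

end ChartTransfer

section Connectivity

variable {E : Type*} [NormedAddCommGroup E] [NormedSpace ℝ E] [FiniteDimensional ℝ E]
  {M : Type*} [EMetricSpace M] [ChartedSpace E M] [IsManifold 𝓘(ℝ, E) ∞ M]
  [RiemannianBundle (fun x : M ↦ TangentSpace 𝓘(ℝ, E) x)]
  [IsContMDiffRiemannianBundle 𝓘(ℝ, E) ∞ E (fun x : M ↦ TangentSpace 𝓘(ℝ, E) x)]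
  [IsRiemannianManifold 𝓘(ℝ, E) M]
  {D : ∀ x : M, Submodule ℝ (TangentSpace 𝓘(ℝ, E) x)}

/-- A weak local form of the Chow–Rashevskii theorem: the `d_q`-distances from `x₀` to a nearby point
are bounded, uniformly in `q`. -/
theorem IsBracketGenerating.eventually_horizontalEDist_ne_top (hD : IsBracketGenerating D)
    (x₀ : M) : ∀ᶠ y in 𝓝 x₀, horizontalEDist D x₀ y ≠ ⊤ := by
  have h := IsAttainable.exists_seq_tendsto (d := chartEDist D x₀)
    (chartEDist_self D x₀) (chartEDist_triangle D x₀) (mem_extChartAt_target x₀)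
    (hD.isAttainable_id x₀)
  filter_upwards [(continuousAt_extChartAt (I := 𝓘(ℝ, E)) x₀).eventually h,
    extChartAt_source_mem_nhds (I := 𝓘(ℝ, E)) x₀] with y ⟨L, u, hu, hL⟩ hy
  have hlim : Tendsto (fun n ↦ (extChartAt 𝓘(ℝ, E) x₀).symm (u n)) atTop (𝓝 y) := by
    have hc := continuousAt_extChartAt_symm' (I := 𝓘(ℝ, E)) hy
    have := hc.tendsto.comp hu
    rwa [(extChartAt 𝓘(ℝ, E) x₀).left_inv hy] at this
  refine ((horizontalEDist_le_of_tendsto D hlim (L := ENNReal.ofReal L) fun n ↦ ?_).trans_lt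
    ENNReal.ofReal_lt_top).ne
  have := hL n
  rwa [chartEDist, extChartAt_to_inv] at this

/-- For bracket-generating `D`, points joined by a path are at finite `horizontalEDist`: the finite
classes are open. -/
theorem IsBracketGenerating.horizontalEDist_ne_top (hD : IsBracketGenerating D) {x y : M}
    (γ : Path x y) : horizontalEDist D x y ≠ ⊤ := by
  let s : Set M := {z | horizontalEDist D x z ≠ ⊤}
  have hopen : IsOpen s := by
    refine isOpen_iff_mem_nhds.2 fun z hz ↦ ?_
    filter_upwards [hD.eventually_horizontalEDist_ne_top z] with w hw
    exact ne_top_of_le_ne_top (ENNReal.add_ne_top.2 ⟨hz, hw⟩) (horizontalEDist_triangle D x z w)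
  have hclosed : IsClosed s := by
    refine isOpen_compl_iff.1 (isOpen_iff_mem_nhds.2 fun z hz ↦ ?_)
    filter_upwards [hD.eventually_horizontalEDist_ne_top z] with w hw hws
    rw [horizontalEDist_comm] at hw
    exact hz (ne_top_of_le_ne_top (ENNReal.add_ne_top.2 ⟨hws, hw⟩)
      (horizontalEDist_triangle D x w z))
  have hx : x ∈ s := by
    change horizontalEDist D x x ≠ ⊤
    simp [horizontalEDist_self]
  have huniv : γ ⁻¹' s = univ :=
    IsClopen.eq_univ ⟨hclosed.preimage γ.continuous, hopen.preimage γ.continuous⟩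
      ⟨0, by simpa using hx⟩
  have h1 : (1 : unitInterval) ∈ γ ⁻¹' s := huniv ▸ mem_univ _
  have h2 : γ 1 ∈ s := h1
  rwa [γ.target] at h2

end Connectivity

end

theorem theorem3p2
    {E : Type*} [NormedAddCommGroup E] [NormedSpace ℝ E] [FiniteDimensional ℝ E]
    {M : Type*} [EMetricSpace M] [ChartedSpace E M] [IsManifold 𝓘(ℝ, E) ∞ M]
    [RiemannianBundle (fun x : M ↦ TangentSpace 𝓘(ℝ, E) x)]
    [IsContMDiffRiemannianBundle 𝓘(ℝ, E) ∞ E (fun x : M ↦ TangentSpace 𝓘(ℝ, E) x)]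
    [IsRiemannianManifold 𝓘(ℝ, E) M] [CompleteSpace M]
    (D : ∀ x : M, Submodule ℝ (TangentSpace 𝓘(ℝ, E) x))
    (hD : IsSmoothSubbundle D) (hbracket : IsBracketGenerating D)
    (x y : M) (γ : ℕ+ → Path x y) (hγ : ∀ q : ℕ+, IsMinimisingGeodesic D q (γ q)) :
    ∃ φ : ℕ → ℕ+, StrictMono φ ∧
      ∃ γlim : Path x y, TendstoUniformly (fun j t ↦ γ (φ j) t) γlim atTop :=
  exists_subseq_of_horizontalEDist_ne_top D (hbracket.horizontalEDist_ne_top (γ 1)) γ hγ
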